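/- Let $(X,\rho)$ be a nonempty compact metric space and let $T\colon X\to X$ be a homeomorphism that is free, i.e. $T^nx\neq x$ for every $x\in X$ and every $n\in\mathbb{Z}\setminus\{0\}$. Let $C(X)\rtimes_T\mathbb{Z}$ be the crossed product, i.e. the universal unital $\mathrm{C}^*$-algebra generated by a copy of $C(X)$ and a unitary $u$ with $ufu^*=f\circ T^{-1}$ for $f\in C(X)$. For a unital $\mathrm{C}^*$-algebra $A$, let $T(A)$ be the set of its tracial states with the weak$^*$-topology. Let $\mathrm{Prob}_T(X)$ be the space of $T$-invariant Borel probability measures on $X$ with the weak$^*$-topology, and for $\mu,\nu\in\mathrm{Prob}_T(X)$ let $$\bar\rho(\mu,\nu)=\inf_{\pi\in J(\mu,\nu)}\int_{X\times X}\rho(x,y)\,d\pi(x,y),$$ where $J(\mu,\nu)$ is the set of joinings of $\mu$ and $\nu$, i.e. of $T\times T$-invariant Borel probability measures on $X\times X$ with first marginal $\mu$ and second marginal $\nu$. Then there is a homeomorphism $T(C(X)\rtimes_T\mathbb{Z})\to\mathrm{Prob}_T(X)$, $\tau\mapsto\mu_\tau$, determined by $\tau(f)=\int_X f\,d\mu_\tau$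 for all $f\in C(X)$, and, with $\bar\rho(\sigma,\tau):=\bar\rho(\mu_\sigma,\mu_\tau)$, the pair $(A,\bar\rho)$ with $A=C(X)\rtimes_T\mathbb{Z}$ is a tracially lyriform $\mathrm{C}^*$-algebra. That is: $A$ is separable and unital, $T(A)$ is nonempty, $\bar\rho$ is a metric on $T(A)$, and 1. the diameter $D$ of $(T(A),\bar\rho)$ is finite; 2. $\bar\rho$ is lower semicontinuous on $T(A)\times T(A)$ with respect to the product of the weak$^*$-topologies; 3. $\bar\rho$ is effectively quasiconvex: there is an increasing function $h\colon[0,D]\to[0,\infty)$ with $\lim_{x\to0}h(x)=0$ such that $$\bar\rho\Big(\sum_{i=1}^n\lambda_i\sigma_i,\sum_{i=1}^n\lambda_i\tau_i\Big)\le h\Big(\max_{1\le i\le n}\bar\rho(\sigma_i,\tau_i)\Big)$$ for all $n\ge1$, all $\sigma_i,\tau_i\in T(A)$ and all $\lambda_i\in[0,1]$ with $\sum_{i=1}^n\lambda_i=1$; 4. the set of $a\in A$ for which $\sup\{|\sigma(a)-\tau(a)|/\bar\rho(\sigma,\tau) : \sigma\neq\tau\in T(A)\}$ is finite is norm-dense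 in $A$. -/

import Mathlib

open MeasureTheory Filter Topology
open scoped ENNReal ComplexOrder

universe u v

noncomputable section

/-! ## Traces and tracially lyriform C*-algebras -/

section Traces

variable (A : Type v) [CStarAlgebra A]

/-- The tracial states of a unital C*-algebra `A`, as a subset of the dual of `A`. -/
def tracialStates : Set (WeakDual ℂ A) :=
  {τ | (∀ a : A, 0 ≤ τ (star a * a)) ∧ ‖WeakDual.toStrongDual τ‖ = 1 ∧ τ 1 = 1 ∧
    ∀ (a : A) (w : unitary A), τ ((w : A) * a * star (w : A)) = τ a}

/-- The trace space `T(A)`, with the weak* topology (it is a subspace of `WeakDual ℂ A`). -/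
abbrev TraceSpace : Type v := tracialStates A

variable {A}

theorem sum_smul_mem_tracialStates {n : ℕ} {c : Fin n → ℝ} (hc : c ∈ stdSimplex ℝ (Fin n))
    (σ : Fin n → TraceSpace A) :
    (∑ i, (c i : ℂ) • (σ i : WeakDual ℂ A)) ∈ tracialStates A := by
  have hev : ∀ a : A, (∑ i, (c i : ℂ) • (σ i : WeakDual ℂ A)) a
      = ∑ i, (c i : ℂ) * (σ i : WeakDual ℂ A) a := by
    intro a
    change (WeakDual.toStrongDual (∑ i, (c i : ℂ) • (σ i : WeakDual ℂ A))) a = _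
    simp only [map_sum, map_smul, sum_apply, smul_apply,
      smul_eq_mul]
    rfl
  have hsum : ∑ i, (c i : ℂ) = 1 := by exact_mod_cast hc.2
  have hone : (∑ i, (c i : ℂ) • (σ i : WeakDual ℂ A)) (1 : A) = 1 := by
    rw [hev]
    simp only [(σ _).2.2.2.1, mul_one, hsum]
  refine ⟨fun a => ?_, le_antisymm ?_ ?_, hone, fun a w => ?_⟩
  · rw [hev]
    exact Finset.sum_nonneg fun i _ =>
      mul_nonneg (by exact_mod_cast hc.1 i) ((σ i).2.1 a)
  · rw [map_sum]
    refine (norm_sum_le _ _).trans ?_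
    simp only [map_smul, norm_smul, (σ _).2.2.1, mul_one, Complex.norm_real, Real.norm_eq_abs]
    rw [← hc.2]
    exact Finset.sum_le_sum fun i _ => (abs_of_nonneg (hc.1 i)).le
  · have hnt : Nontrivial A := by
      refine ⟨⟨1, 0, fun h => ?_⟩⟩
      rw [h, map_zero] at hone
      exact zero_ne_one hone
    have h1 := (WeakDual.toStrongDual (∑ i, (c i : ℂ) • (σ i : WeakDual ℂ A))).le_opNorm (1 : A)
    rw [show (WeakDual.toStrongDual (∑ i, (c i : ℂ) • (σ i : WeakDual ℂ A))) (1 : A) = 1 from hone,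
      norm_one, norm_one, mul_one] at h1
    exact h1
  · rw [hev, hev]
    simp only [(σ _).2.2.2.2 a w]

/-- The convex combination `∑ i, c i • σ i` of traces. -/
def TraceSpace.convexComb {n : ℕ} (c : Fin n → ℝ) (hc : c ∈ stdSimplex ℝ (Fin n))
    (σ : Fin n → TraceSpace A) : TraceSpace A :=
  ⟨∑ i, (c i : ℂ) • (σ i : WeakDual ℂ A), sum_smul_mem_tracialStates hc σ⟩

/-- The seminorm `L_ρ(a) = sup {|σ(a) - τ(a)| / ρ(σ, τ) | σ ≠ τ}` with values in `[0, ∞]`. -/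
def tracialLipschitzSeminorm (ρ : TraceSpace A → TraceSpace A → ℝ) (a : A) : ℝ≥0∞ :=
  ⨆ (σ : TraceSpace A) (τ : TraceSpace A) (_ : σ ≠ τ),
    ENNReal.ofReal (‖(σ : WeakDual ℂ A) a - (τ : WeakDual ℂ A) a‖ / ρ σ τ)

variable (A)

/-- `(A, ρ)` is a tracially lyriform C*-algebra. -/
structure IsTraciallyLyriform (ρ : TraceSpace A → TraceSpace A → ℝ) : Prop where
  /-- `A` is separable. -/
  separable : TopologicalSpace.SeparableSpace A
  /-- The trace space is nonempty (all metric spaces are nonempty by convention). -/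
  nonempty : Nonempty (TraceSpace A)
  /-- `ρ` is a metric on the trace space. -/
  eq_zero_iff : ∀ σ τ, ρ σ τ = 0 ↔ σ = τ
  symm : ∀ σ τ, ρ σ τ = ρ τ σ
  triangle : ∀ σ τ υ, ρ σ υ ≤ ρ σ τ + ρ τ υ
  /-- The diameter is finite. -/
  finite_diam : BddAbove (Set.range fun p : TraceSpace A × TraceSpace A => ρ p.1 p.2)
  /-- `ρ` is lower semicontinuous for the product of the weak* topologies. -/
  lowerSemicontinuous : LowerSemicontinuous fun p : TraceSpace A × TraceSpace A => ρ p.1 p.2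
  /-- `ρ` is effectively quasiconvex; `D` is the diameter, and the inequality
  `ρ (σ i) (τ i) ≤ M` for all `i` with equality for some `i` says that `M` is the maximum. -/
  effectively_quasiconvex :
    ∃ h : ℝ → ℝ,
      let D := ⨆ p : TraceSpace A × TraceSpace A, ρ p.1 p.2
      MonotoneOn h (Set.Icc 0 D) ∧ (∀ x ∈ Set.Icc 0 D, 0 ≤ h x) ∧
      Tendsto h (𝓝[Set.Icc 0 D] 0) (𝓝 0) ∧
      ∀ (n : ℕ) (c : Fin n → ℝ) (hc : c ∈ stdSimplex ℝ (Fin n)) (σ τ : Fin n → TraceSpace A)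
        (M : ℝ), IsGreatest (Set.range fun i => ρ (σ i) (τ i)) M →
        ρ (TraceSpace.convexComb c hc σ) (TraceSpace.convexComb c hc τ) ≤ h M
  /-- Tracially `ρ`-Lipschitz elements are norm-dense. -/
  dense_lipschitz : Dense {a : A | tracialLipschitzSeminorm ρ a < ⊤}

end Traces

/-! ## The crossed product `C(X) ⋊ ℤ` -/

section CrossedProduct

variable {X : Type u} [TopologicalSpace X] [CompactSpace X]

/-- A (unital) covariant pair for the homeomorphism `T` in a nonzero unital C*-algebra `B`: a
unital *-homomorphism `φ : C(X) → B` and a unitary `w` of `B` with `w φ(f) w* = φ(f ∘ T⁻¹)`. -/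
structure CovariantPair (T : X ≃ₜ X) : Type (u + 1) where
  B : Type u
  [cstar : CStarAlgebra B]
  [nontrivial : Nontrivial B]
  φ : C(X, ℂ) →⋆ₐ[ℂ] B
  w : unitary B
  covariant : ∀ f : C(X, ℂ),
    (w : B) * φ f * star (w : B) = φ (f.comp (T.symm : C(X, X)))

attribute [instance] CovariantPair.cstar CovariantPair.nontrivial

/-- The `ℓ^∞`-product of the targets of all covariant pairs. -/
abbrev CovariantProduct (T : X ≃ₜ X) : Type (u + 1) :=
  lp (fun π : CovariantPair T => π.B) ∞

instance (T : X ≃ₜ X) : CStarAlgebra (CovariantProduct T) where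

/-- The diagonal *-homomorphism `f ↦ (φ_π(f))_π`. -/
def covariantProductHom (T : X ≃ₜ X) : C(X, ℂ) →⋆ₐ[ℂ] CovariantProduct T where
  toFun f := ⟨fun π => π.φ f, memℓp_infty ⟨‖f‖, by
    rintro _ ⟨π, rfl⟩
    exact NonUnitalStarAlgHom.norm_apply_le π.φ f⟩⟩
  map_one' := by ext π; exact map_one π.φ
  map_mul' f g := by ext π; exact map_mul π.φ f g
  map_zero' := by ext π; exact map_zero π.φ
  map_add' f g := by ext π; exact map_add π.φ f g
  commutes' r := by ext π; exact AlgHomClass.commutes π.φ r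
  map_star' f := by ext π; exact map_star π.φ f

/-- The diagonal unitary `(w_π)_π`. -/
def covariantProductUnitary (T : X ≃ₜ X) : CovariantProduct T :=
  ⟨fun π => (π.w : π.B), memℓp_infty ⟨1, by
    rintro _ ⟨π, rfl⟩
    exact CStarRing.norm_coe_unitary π.w |>.le⟩⟩

/-- The closed *-subalgebra of the product of all covariant pairs generated by the diagonal copies
of `C(X)` and of the unitary. -/
def crossedProductSubalgebra (T : X ≃ₜ X) : StarSubalgebra ℂ (CovariantProduct T) :=
  (StarAlgebra.adjoin ℂ
    (Set.range (covariantProductHom T) ∪ {covariantProductUnitary T})).topologicalClosure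

/-- The (full) crossed product `C(X) ⋊_T ℤ`, i.e. the universal C*-algebra generated by a copy of
`C(X)` and a unitary `w` with `w f w* = f ∘ T⁻¹`. -/
def CrossedProduct (T : X ≃ₜ X) : Type (u + 1) := crossedProductSubalgebra T

instance (T : X ≃ₜ X) : CStarAlgebra (crossedProductSubalgebra T) where
  complete := (StarSubalgebra.isClosed_topologicalClosure _).completeSpace_coe.complete

instance (T : X ≃ₜ X) : CStarAlgebra (CrossedProduct T) :=
  inferInstanceAs (CStarAlgebra (crossedProductSubalgebra T))

/-- The canonical *-homomorphism `C(X) → C(X) ⋊_T ℤ`. -/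
def crossedProductIncl (T : X ≃ₜ X) : C(X, ℂ) →⋆ₐ[ℂ] CrossedProduct T :=
  ((covariantProductHom T).codRestrict (crossedProductSubalgebra T) fun f =>
    StarSubalgebra.le_topologicalClosure _
      (StarAlgebra.subset_adjoin ℂ _ (Or.inl ⟨f, rfl⟩)) :
    C(X, ℂ) →⋆ₐ[ℂ] crossedProductSubalgebra T)

end CrossedProduct

/-! ## Invariant measures, joinings and the metric `ρ̄` -/

section Dynamics

/-- `T` is free: the action of `ℤ` generated by `T` has no fixed points. -/
def IsFreeHomeo {X : Type u} [TopologicalSpace X] (T : X ≃ₜ X) : Prop :=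
  ∀ n : ℤ, n ≠ 0 → ∀ x : X, (T ^ n) x ≠ x

variable {X : Type u} [MetricSpace X] [CompactSpace X] [MeasurableSpace X] [BorelSpace X]

/-- The space of `T`-invariant Borel probability measures, with the weak* topology. -/
abbrev InvariantProb (T : X ≃ₜ X) : Type u :=
  {μ : ProbabilityMeasure X // MeasurePreserving T (μ : Measure X) (μ : Measure X)}

/-- The joinings of `μ` and `ν`: the `T × T`-invariant probability measures on `X × X` with
marginals `μ` and `ν`. -/
def joinings (T : X ≃ₜ X) (μ ν : InvariantProb T) : Set (Measure (X × X)) :=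
  {π | IsProbabilityMeasure π ∧ MeasurePreserving (Prod.map T T) π π ∧
    π.map Prod.fst = (μ.1 : Measure X) ∧ π.map Prod.snd = (ν.1 : Measure X)}

/-- `ρ̄(μ, ν)`, the infimum of `∫ ρ(x, y) dπ(x, y)` over all joinings `π` of `μ` and `ν`. -/
def dbar (T : X ≃ₜ X) (μ ν : InvariantProb T) : ℝ :=
  sInf ((fun π : Measure (X × X) => ∫ p, dist p.1 p.2 ∂π) '' joinings T μ ν)

end Dynamics

end

/-! The elements `f u ^ n` span a dense subspace of the crossed product. A trace vanishes on them
for `n ≠ 0`: freeness gives, around each point, bump functions that `T ^ (-n)` moves off themselves,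
and the trace property then kills `f u ^ n` locally (`trace_monomial_eq_zero`). Hence a trace is
determined by its restriction to `C(X)`. By Riesz this restriction is integration against a
probability measure, and conjugation by `u` makes that measure invariant. Conversely, composing an
invariant measure with the conditional expectation `E`, a diagonal matrix coefficient of the regular
representation, gives a trace. Both directions are weak* continuous.

On the side of measures, `dbar` is a Wasserstein distance restricted to invariant couplings. The
triangle inequality comes from gluing two joinings relatively independently over their common
marginal; uniqueness of disintegrations keeps the result invariant (`exists_gluing`). Compactness of
the space of probability measures on `X × X` gives lower semicontinuity, and mixing joinings gives
joint quasiconvexity, so `h` can be the identity. Integrals of a `K`-Lipschitz function differ by at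
most `K * dbar`. With Stone–Weierstrass this separates measures and, since every monomial with `n ≠
0` has trace zero, also gives density of the tracially Lipschitz elements. -/

noncomputable section

set_option linter.unusedSectionVars false

/-! ### Density of Lipschitz functions -/

section LipschitzFunctions

/-- The Lipschitz functions form a unital *-subalgebra of `C(X, ℂ)`. -/
def lipschitzSubalgebra (X : Type u) [MetricSpace X] [CompactSpace X] :
    StarSubalgebra ℂ C(X, ℂ) where
  carrier := {f | ∃ K, LipschitzWith K f}
  mul_mem' := by
    rintro f g ⟨K, hK⟩ ⟨L, hL⟩
    refine ⟨‖f‖₊ * L + ‖g‖₊ * K, LipschitzWith.of_dist_le_mul fun x y => ?_⟩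
    have h1 := hK.dist_le_mul x y
    have h2 := hL.dist_le_mul x y
    rw [dist_eq_norm] at h1 h2 ⊢
    have h3 := f.norm_coe_le_norm x
    have h4 := g.norm_coe_le_norm y
    have h5 : (f * g) x - (f * g) y = f x * (g x - g y) + (f x - f y) * g y := by
      simp only [ContinuousMap.mul_apply]; ring
    rw [h5]
    refine (norm_add_le _ _).trans ?_
    rw [norm_mul, norm_mul]
    push_cast
    have h6 : ‖f x‖ * ‖g x - g y‖ ≤ ‖f‖ * (L * dist x y) := by gcongr
    have h7 : ‖f x - f y‖ * ‖g y‖ ≤ (K * dist x y) * ‖g‖ := by gcongr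
    linarith
  add_mem' := by
    rintro f g ⟨K, hK⟩ ⟨L, hL⟩
    exact ⟨K + L, hK.add hL⟩
  algebraMap_mem' r := ⟨0, LipschitzWith.const r⟩
  star_mem' := by
    rintro f ⟨K, hK⟩
    exact ⟨K, LipschitzWith.of_dist_le_mul fun x y => by
      simpa [dist_eq_norm, ← map_sub] using hK.dist_le_mul x y⟩

/-- Stone–Weierstrass: the 1-Lipschitz functions `dist · y` already separate points. -/
theorem dense_lipschitz_continuousMap (X : Type u) [MetricSpace X] [CompactSpace X] :
    Dense {f : C(X, ℂ) | ∃ K, LipschitzWith K f} := by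
  have h := ContinuousMap.starSubalgebra_topologicalClosure_eq_top_of_separatesPoints
    (lipschitzSubalgebra X) (by
      intro x y hxy
      refine ⟨fun z => (dist z y : ℂ), ⟨⟨fun z => (dist z y : ℂ), by fun_prop⟩, ⟨1, ?_⟩, rfl⟩, ?_⟩
      · refine LipschitzWith.of_dist_le_mul fun a b => ?_
        simp only [ContinuousMap.coe_mk, Complex.dist_eq, ← Complex.ofReal_sub, Complex.norm_real,
          NNReal.coe_one, one_mul]
        exact abs_dist_sub_le a b y
      · simpa using hxy)
  intro f
  have : f ∈ (lipschitzSubalgebra X).topologicalClosure := by rw [h]; trivial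
  exact this

end LipschitzFunctions

/-! ### Joinings and elementary properties of `dbar` -/

section Joinings

variable {X : Type u} [MetricSpace X] [CompactSpace X] [MeasurableSpace X] [BorelSpace X]
  {T : X ≃ₜ X}

theorem ProbabilityMeasure.ext_of_integral_complex {μ ν : ProbabilityMeasure X}
    (h : ∀ f : C(X, ℂ), ∫ x, f x ∂(μ : Measure X) = ∫ x, f x ∂(ν : Measure X)) : μ = ν := by
  apply ProbabilityMeasure.toMeasure_injective
  refine ext_of_forall_integral_eq_of_IsFiniteMeasure fun f => ?_
  have := h ⟨fun x => (f x : ℂ), by fun_prop⟩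
  simp only [ContinuousMap.coe_mk, integral_complex_ofReal] at this
  exact_mod_cast this

theorem ContinuousMap.integrable_of_compactSpace {Y E : Type*} [TopologicalSpace Y] [CompactSpace Y]
    [MeasurableSpace Y] [OpensMeasurableSpace Y] [NormedAddCommGroup E]
    [SecondCountableTopologyEither Y E] {f : Y → E} (hf : Continuous f)
    (μ : Measure Y) [IsFiniteMeasure μ] : Integrable f μ :=
  hf.integrable_of_hasCompactSupport (HasCompactSupport.of_compactSpace f)

theorem integrable_dist_prod (π : Measure (X × X)) [IsFiniteMeasure π] :
    Integrable (fun p : X × X => dist p.1 p.2) π :=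
  ContinuousMap.integrable_of_compactSpace (by fun_prop) π

/-- Makes the infimum in `dbar` a genuine one; the real `sInf` of an empty set would be `0`. -/
theorem prod_mem_joinings (μ ν : InvariantProb T) :
    (μ.1 : Measure X).prod (ν.1 : Measure X) ∈ joinings T μ ν :=
  ⟨inferInstance, μ.2.prod ν.2, by simp, by simp⟩

theorem bddBelow_dist_integral (μ ν : InvariantProb T) :
    BddBelow ((fun π : Measure (X × X) => ∫ p, dist p.1 p.2 ∂π) '' joinings T μ ν) :=
  ⟨0, by rintro _ ⟨π, -, rfl⟩; exact integral_nonneg fun _ => dist_nonneg⟩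

theorem dbar_le_integral {μ ν : InvariantProb T} {π : Measure (X × X)} (hπ : π ∈ joinings T μ ν) :
    dbar T μ ν ≤ ∫ p, dist p.1 p.2 ∂π :=
  csInf_le (bddBelow_dist_integral μ ν) ⟨π, hπ, rfl⟩

/-- Near-optimal joinings suffice throughout; attainment of the infimum is never needed. -/
theorem exists_mem_joinings_lt {μ ν : InvariantProb T} {c : ℝ} (h : dbar T μ ν < c) :
    ∃ π ∈ joinings T μ ν, ∫ p, dist p.1 p.2 ∂π < c := by
  obtain ⟨_, ⟨π, hπ, rfl⟩, h⟩ := exists_lt_of_csInf_lt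
    (Set.Nonempty.image _ ⟨_, prod_mem_joinings μ ν⟩) h
  exact ⟨π, hπ, h⟩

theorem dbar_nonneg (μ ν : InvariantProb T) : 0 ≤ dbar T μ ν :=
  Real.sInf_nonneg (by rintro _ ⟨π, -, rfl⟩; exact integral_nonneg fun _ => dist_nonneg)

theorem dbar_self (μ : InvariantProb T) : dbar T μ μ = 0 := by
  refine le_antisymm ?_ (dbar_nonneg μ μ)
  have hd : Measurable fun x : X => (x, x) := by fun_prop
  have hT : Measurable T := T.continuous.measurable
  -- The diagonal joining has zero cost.
  have hmem : (μ.1 : Measure X).map (fun x => (x, x)) ∈ joinings T μ μ := by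
    refine ⟨Measure.isProbabilityMeasure_map hd.aemeasurable, ⟨by fun_prop, ?_⟩, ?_, ?_⟩
    · rw [Measure.map_map (by fun_prop) hd]
      conv_rhs => rw [← μ.2.map_eq, Measure.map_map hd hT]
      rfl
    · rw [Measure.map_map (by fun_prop) hd]; exact Measure.map_id
    · rw [Measure.map_map (by fun_prop) hd]; exact Measure.map_id
  refine (dbar_le_integral hmem).trans_eq ?_
  rw [integral_map hd.aemeasurable (by fun_prop)]
  simp

theorem dbar_comm_le (μ ν : InvariantProb T) : dbar T ν μ ≤ dbar T μ ν := by
  refine le_of_forall_gt_imp_ge_of_dense fun c hc => ?_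
  obtain ⟨π, ⟨h1, h2, h3, h4⟩, h⟩ := exists_mem_joinings_lt hc
  have hT : Measurable T := T.continuous.measurable
  have hmem : π.map Prod.swap ∈ joinings T ν μ := by
    refine ⟨Measure.isProbabilityMeasure_map measurable_swap.aemeasurable, ⟨by fun_prop, ?_⟩, ?_, ?_⟩
    · rw [Measure.map_map (by fun_prop) measurable_swap]
      conv_rhs => rw [← h2.map_eq, Measure.map_map measurable_swap (by fun_prop)]
      rfl
    · rw [Measure.map_map (by fun_prop) measurable_swap]; exact h4
    · rw [Measure.map_map (by fun_prop) measurable_swap]; exact h3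
  refine (dbar_le_integral hmem).trans ?_
  rw [integral_map measurable_swap.aemeasurable (by fun_prop)]
  simp only [Prod.fst_swap, Prod.snd_swap, dist_comm (Prod.snd _)]
  exact h.le

theorem dbar_comm (μ ν : InvariantProb T) : dbar T μ ν = dbar T ν μ :=
  le_antisymm (dbar_comm_le ν μ) (dbar_comm_le μ ν)

theorem dbar_le_diam (μ ν : InvariantProb T) : dbar T μ ν ≤ Metric.diam (Set.univ : Set X) := by
  refine (dbar_le_integral (prod_mem_joinings μ ν)).trans ?_
  calc _ ≤ ∫ _ : X × X, Metric.diam (Set.univ : Set X) ∂((μ.1 : Measure X).prod (ν.1 : Measure X)) :=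
        integral_mono (integrable_dist_prod _) (integrable_const _) fun p =>
          Metric.dist_le_diam_of_mem isCompact_univ.isBounded trivial trivial
    _ = _ := by simp

/-- The easy half of Kantorovich duality: under any joining, the difference of integrals is the
integral of `f x - f y`, bounded by `K * dist x y`. It serves both to separate measures and to
produce tracially Lipschitz elements. -/
theorem norm_integral_sub_le_dbar {μ ν : InvariantProb T} {f : X → ℂ} {K : NNReal}
    (hf : LipschitzWith K f) :
    ‖∫ x, f x ∂(μ.1 : Measure X) - ∫ x, f x ∂(ν.1 : Measure X)‖ ≤ K * dbar T μ ν := by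
  have key : ∀ c, dbar T μ ν < c →
      ‖∫ x, f x ∂(μ.1 : Measure X) - ∫ x, f x ∂(ν.1 : Measure X)‖ ≤ K * c := by
    intro c hc
    obtain ⟨π, ⟨h1, h2, h3, h4⟩, h⟩ := exists_mem_joinings_lt hc
    have hfc := hf.continuous
    rw [← h3, ← h4, integral_map (by fun_prop) hfc.aestronglyMeasurable,
      integral_map (by fun_prop) hfc.aestronglyMeasurable, ← integral_sub
        (ContinuousMap.integrable_of_compactSpace (by fun_prop) π)
        (ContinuousMap.integrable_of_compactSpace (by fun_prop) π)]
    refine (norm_integral_le_integral_norm _).trans ?_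
    refine (integral_mono (ContinuousMap.integrable_of_compactSpace (by fun_prop) π)
      ((integrable_dist_prod π).const_mul (K : ℝ)) fun p => ?_).trans ?_
    · simpa [dist_eq_norm] using hf.dist_le_mul p.1 p.2
    · rw [integral_const_mul]
      gcongr
  refine le_of_forall_pos_le_add fun ε hε => ?_
  -- Dividing by `K + 1` instead of `K` covers `K = 0`.
  have hK : (0 : ℝ) < K + 1 := by positivity
  refine (key (dbar T μ ν + ε / (K + 1)) (by linarith [div_pos hε hK])).trans ?_
  have : (K : ℝ) * (ε / (K + 1)) ≤ ε := by
    rw [← mul_div_assoc, div_le_iff₀ hK]; nlinarith [K.2]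
  linarith

theorem continuous_integral_continuousMap_complex (μ : Measure X) [IsFiniteMeasure μ] :
    Continuous fun f : C(X, ℂ) => ∫ x, f x ∂μ := by
  refine (LipschitzWith.of_dist_le_mul (K := (μ.real Set.univ).toNNReal) fun f g => ?_).continuous
  rw [dist_eq_norm, dist_eq_norm, ← integral_sub
    (ContinuousMap.integrable_of_compactSpace f.continuous μ)
    (ContinuousMap.integrable_of_compactSpace g.continuous μ), Real.coe_toNNReal _ (by positivity),
    mul_comm]
  exact norm_integral_le_of_norm_le_const (.of_forall fun x => (f - g).norm_coe_le_norm x)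

theorem dbar_eq_zero_iff {μ ν : InvariantProb T} : dbar T μ ν = 0 ↔ μ = ν := by
  refine ⟨fun h => ?_, by rintro rfl; exact dbar_self μ⟩
  apply Subtype.ext
  refine ProbabilityMeasure.ext_of_integral_complex fun f => ?_
  refine (dense_lipschitz_continuousMap X).induction (P := fun f : C(X, ℂ) =>
    ∫ x, f x ∂(μ.1 : Measure X) = ∫ x, f x ∂(ν.1 : Measure X)) ?_ (isClosed_eq
      (continuous_integral_continuousMap_complex _) (continuous_integral_continuousMap_complex _)) f
  rintro f ⟨K, hK⟩
  have := norm_integral_sub_le_dbar (μ := μ) (ν := ν) hK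
  rw [h, mul_zero, norm_le_zero_iff, sub_eq_zero] at this
  exact this

end Joinings

/-! ### Gluing of joinings and the triangle inequality -/

section Gluing

open ProbabilityTheory

variable {X : Type u} [MetricSpace X] [CompactSpace X] [MeasurableSpace X] [BorelSpace X]
  {T : X ≃ₜ X}

/-- The disintegration of a `T × T`-invariant measure is equivariant. -/
theorem condKernel_map_ae_eq [Nonempty X] (π : Measure (X × X)) [IsProbabilityMeasure π]
    (h : MeasurePreserving (Prod.map T T) π π) (h1 : MeasurePreserving T π.fst π.fst) :
    ∀ᵐ y ∂π.fst, π.condKernel (T y) = (π.condKernel y).map T := by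
  have hT : Measurable T := T.continuous.measurable
  have hT' : Measurable T.symm := T.symm.continuous.measurable
  -- Transporting the fibre over `T y` back by `T⁻¹` gives a second disintegration of `π`, by
  -- invariance of `π` and of its first marginal. Almost everywhere uniqueness then yields the
  -- claim.
  have key : π = π.fst ⊗ₘ ((π.condKernel.comap T hT).map T.symm) := by
    have : IsMarkovKernel ((π.condKernel.comap T hT).map T.symm) := Kernel.IsMarkovKernel.map _ hT'
    refine Measure.ext_of_lintegral _ fun f hf => ?_
    rw [Measure.lintegral_compProd hf]
    have e1 : ∀ y, ∫⁻ z, f (y, z) ∂((π.condKernel.comap T hT).map T.symm) y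
        = ∫⁻ z, f (T.symm (T y), T.symm z) ∂π.condKernel (T y) := by
      intro y
      rw [Kernel.map_apply _ hT', Kernel.comap_apply, lintegral_map (by fun_prop) hT']
      simp
    simp_rw [e1]
    have e2 := h1.lintegral_comp (f := fun y => ∫⁻ z, f (T.symm y, T.symm z) ∂π.condKernel y)
      (Measurable.lintegral_kernel_prod_right' (f := fun p : X × X => f (T.symm p.1, T.symm p.2))
        (by fun_prop))
    rw [e2, ← Measure.lintegral_compProd (f := fun p : X × X => f (T.symm p.1, T.symm p.2))
      (by fun_prop), Measure.disintegrate,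
      ← h.lintegral_comp (f := fun p : X × X => f (T.symm p.1, T.symm p.2)) (by fun_prop)]
    simp
  have : IsMarkovKernel ((π.condKernel.comap T hT).map T.symm) := Kernel.IsMarkovKernel.map _ hT'
  filter_upwards [eq_condKernel_of_measure_eq_compProd _ key] with y hy
  rw [← hy, Kernel.map_apply _ hT', Kernel.comap_apply, Measure.map_map hT hT']
  have : (T ∘ T.symm : X → X) = id := by ext; simp
  rw [this, Measure.map_id]

/-- Gluing of joinings: two joinings have a common extension, whose outer marginal is again a
joining. -/
theorem exists_gluing {μ ν υ : InvariantProb T} {π₁ π₂ : Measure (X × X)}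
    (h₁ : π₁ ∈ joinings T μ ν) (h₂ : π₂ ∈ joinings T ν υ) :
    ∃ l : Measure (X × X × X), IsProbabilityMeasure l ∧ l.map (fun p => (p.2.1, p.1)) = π₁ ∧
      l.map (fun p => (p.1, p.2.2)) = π₂ ∧ l.map Prod.snd ∈ joinings T μ υ := by
  have hne : Nonempty X := (ν.1 : ProbabilityMeasure X).nonempty
  have hT : Measurable T := T.continuous.measurable
  obtain ⟨p1, i1, a1, b1⟩ := h₁
  obtain ⟨p2, i2, a2, b2⟩ := h₂
  -- The swap puts `ν` in the first coordinate, so that both joinings disintegrate over it.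
  set ρ : Measure (X × X) := π₁.map Prod.swap with hρ
  have pρ : IsProbabilityMeasure ρ := Measure.isProbabilityMeasure_map measurable_swap.aemeasurable
  have fρ : ρ.fst = (ν.1 : Measure X) := by
    rw [hρ, Measure.fst_map_swap]; exact b1
  have f2 : π₂.fst = (ν.1 : Measure X) := a2
  have iρ : MeasurePreserving (Prod.map T T) ρ ρ := by
    refine ⟨by fun_prop, ?_⟩
    rw [hρ, Measure.map_map (by fun_prop) measurable_swap]
    conv_rhs => rw [← i1.map_eq, Measure.map_map measurable_swap (by fun_prop)]
    rfl
  have k1 := condKernel_map_ae_eq ρ iρ (by rw [fρ]; exact ν.2)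
  have k2 := condKernel_map_ae_eq π₂ i2 (by rw [f2]; exact ν.2)
  rw [fρ] at k1
  rw [f2] at k2
  -- The relatively independent product over `ν`, with the common coordinate first: points are `(y,
  -- x, z)`.
  set l : Measure (X × X × X) := (ν.1 : Measure X) ⊗ₘ (ρ.condKernel ×ₖ π₂.condKernel) with hl
  have pl : IsProbabilityMeasure l := by rw [hl]; infer_instance
  have hlint : ∀ f : X × X × X → ℝ≥0∞, Measurable f → ∫⁻ p, f p ∂l =
      ∫⁻ y, ∫⁻ x, ∫⁻ z, f (y, x, z) ∂π₂.condKernel y ∂ρ.condKernel y ∂(ν.1 : Measure X) := by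
    intro f hf
    rw [hl, Measure.lintegral_compProd hf]
    refine lintegral_congr fun y => ?_
    rw [Kernel.lintegral_prod _ _ _ (by fun_prop)]
  have m1 : l.map (fun p => (p.2.1, p.1)) = π₁ := by
    refine Measure.ext_of_lintegral _ fun f hf => ?_
    rw [lintegral_map hf (by fun_prop), hlint _ (by fun_prop)]
    simp only [lintegral_const, measure_univ, mul_one]
    have : ∫⁻ p, f p.swap ∂ρ = ∫⁻ p, f p ∂π₁ := by
      rw [hρ, lintegral_map (by fun_prop) measurable_swap]; simp
    rw [← this]
    conv_rhs => rw [← ρ.disintegrate ρ.condKernel, Measure.lintegral_compProd (by fun_prop), fρ]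
    rfl
  have m2 : l.map (fun p => (p.1, p.2.2)) = π₂ := by
    refine Measure.ext_of_lintegral _ fun f hf => ?_
    rw [lintegral_map hf (by fun_prop), hlint _ (by fun_prop)]
    simp only [lintegral_const, measure_univ, mul_one]
    conv_rhs => rw [← π₂.disintegrate π₂.condKernel, Measure.lintegral_compProd (by fun_prop), f2]
  refine ⟨l, pl, m1, m2, Measure.isProbabilityMeasure_map measurable_snd.aemeasurable,
    ⟨by fun_prop, ?_⟩, ?_, ?_⟩
  · refine Measure.ext_of_lintegral _ fun f hf => ?_
    rw [lintegral_map hf (by fun_prop), lintegral_map (by fun_prop) measurable_snd,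
      lintegral_map hf measurable_snd, hlint _ (by fun_prop), hlint _ (by fun_prop)]
    have hm : Measurable fun y => ∫⁻ x, ∫⁻ z, f (x, z) ∂π₂.condKernel y ∂ρ.condKernel y := by
      have : (fun y => ∫⁻ x, ∫⁻ z, f (x, z) ∂π₂.condKernel y ∂ρ.condKernel y) =
          fun y => ∫⁻ p, f p ∂(ρ.condKernel ×ₖ π₂.condKernel) y := by
        ext y
        rw [Kernel.lintegral_prod _ _ _ hf]
      rw [this]
      exact hf.lintegral_kernel
    -- Replacing `y` by `T y` under the invariant `ν` lets the equivariance of both kernels move `T`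
    -- into the fibres.
    rw [← ν.2.lintegral_comp hm]
    refine lintegral_congr_ae ?_
    filter_upwards [k1, k2] with y h1 h2
    rw [h1, h2]
    rw [lintegral_map (Measurable.lintegral_prod_right' (f := f) hf) hT]
    refine lintegral_congr fun x => ?_
    rw [lintegral_map (by fun_prop) hT]
    rfl
  · rw [Measure.map_map measurable_fst measurable_snd, ← a1, ← m1,
      Measure.map_map measurable_fst (by fun_prop)]
    rfl
  · rw [Measure.map_map measurable_snd measurable_snd, ← b2, ← m2,
      Measure.map_map measurable_snd (by fun_prop)]
    rfl

/-- The pointwise triangle inequality is integrated against the glued measure of two near-optimal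
joinings. -/
theorem dbar_triangle (μ ν υ : InvariantProb T) : dbar T μ υ ≤ dbar T μ ν + dbar T ν υ := by
  refine le_of_forall_pos_le_add fun ε hε => ?_
  obtain ⟨π₁, h₁, c₁⟩ := exists_mem_joinings_lt (show dbar T μ ν < dbar T μ ν + ε / 2 by linarith)
  obtain ⟨π₂, h₂, c₂⟩ := exists_mem_joinings_lt (show dbar T ν υ < dbar T ν υ + ε / 2 by linarith)
  obtain ⟨l, pl, m1, m2, hl⟩ := exists_gluing h₁ h₂
  have e := dbar_le_integral hl
  rw [integral_map measurable_snd.aemeasurable (by fun_prop)] at e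
  rw [← m1, integral_map (by fun_prop) (by fun_prop)] at c₁
  rw [← m2, integral_map (by fun_prop) (by fun_prop)] at c₂
  have : ∫ p : X × X × X, dist p.2.1 p.2.2 ∂l
      ≤ ∫ p : X × X × X, dist p.2.1 p.1 + dist p.1 p.2.2 ∂l :=
    integral_mono (ContinuousMap.integrable_of_compactSpace (by fun_prop) l)
      (ContinuousMap.integrable_of_compactSpace (by fun_prop) l) fun p => dist_triangle _ _ _
  rw [integral_add (ContinuousMap.integrable_of_compactSpace (by fun_prop) l)
    (ContinuousMap.integrable_of_compactSpace (by fun_prop) l)] at this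
  linarith

end Gluing

/-! ### Semicontinuity, convexity and existence of invariant measures -/

section Topology

variable {X : Type u} [MetricSpace X] [CompactSpace X] [MeasurableSpace X] [BorelSpace X]
  {T : X ≃ₜ X}

/-- Invariance and the cost bound are closed conditions on the compact space of probability measures
on `X × X`. The continuous marginal map sends this compact set to a compact, hence closed, set of
pairs. -/
theorem isClosed_exists_joining_le (c : ℝ) :
    IsClosed {p : InvariantProb T × InvariantProb T |
      ∃ π ∈ joinings T p.1 p.2, ∫ q, dist q.1 q.2 ∂π ≤ c} := by
  have cT : Continuous (Prod.map T T) := by fun_prop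
  let K : Set (ProbabilityMeasure (X × X)) :=
    {π | π.map cT.measurable.aemeasurable = π ∧ ∫ q, dist q.1 q.2 ∂(π : Measure (X × X)) ≤ c}
  have hK : IsCompact K := by
    refine IsClosed.isCompact (IsClosed.inter ?_ ?_)
    · exact isClosed_eq (ProbabilityMeasure.continuous_map cT) continuous_id
    · exact isClosed_le (ProbabilityMeasure.continuous_integral_continuousMap
        (⟨fun q => dist q.1 q.2, continuous_dist⟩ : C(X × X, ℝ))) continuous_const
  let F : ProbabilityMeasure (X × X) → ProbabilityMeasure X × ProbabilityMeasure X :=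
    fun π => (π.map continuous_fst.measurable.aemeasurable,
      π.map continuous_snd.measurable.aemeasurable)
  have hF : Continuous F := (ProbabilityMeasure.continuous_map continuous_fst).prodMk
    (ProbabilityMeasure.continuous_map continuous_snd)
  have hc : Continuous fun p : InvariantProb T × InvariantProb T => (p.1.1, p.2.1) := by fun_prop
  convert (hK.image hF).isClosed.preimage hc using 1
  ext ⟨μ, ν⟩
  simp only [Set.mem_ofPred_eq, Set.mem_preimage, Set.mem_image]
  constructor
  · rintro ⟨π, ⟨h1, h2, h3, h4⟩, h5⟩
    refine ⟨⟨π, h1⟩, ⟨?_, h5⟩, ?_⟩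
    · exact ProbabilityMeasure.toMeasure_injective h2.map_eq
    · exact Prod.ext (ProbabilityMeasure.toMeasure_injective h3)
        (ProbabilityMeasure.toMeasure_injective h4)
  · rintro ⟨π, ⟨h2, h5⟩, h⟩
    refine ⟨π, ⟨inferInstance, ⟨cT.measurable, ?_⟩, ?_, ?_⟩, h5⟩
    · exact congrArg ProbabilityMeasure.toMeasure h2
    · exact congrArg (fun p => ProbabilityMeasure.toMeasure p.1) h
    · exact congrArg (fun p => ProbabilityMeasure.toMeasure p.2) h

theorem lowerSemicontinuous_dbar :
    LowerSemicontinuous fun p : InvariantProb T × InvariantProb T => dbar T p.1 p.2 := by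
  rw [lowerSemicontinuous_iff_isClosed_preimage]
  intro c
  -- The slack `ε` avoids having to find an optimal joining.
  have : (fun p : InvariantProb T × InvariantProb T => dbar T p.1 p.2) ⁻¹' Set.Iic c =
      ⋂ ε : Set.Ioi (0 : ℝ), {p | ∃ π ∈ joinings T p.1 p.2, ∫ q, dist q.1 q.2 ∂π ≤ c + ε} := by
    ext p
    simp only [Set.mem_preimage, Set.mem_Iic, Set.mem_iInter, Set.mem_ofPred_eq]
    constructor
    · rintro h ⟨ε, hε⟩
      obtain ⟨π, h1, h2⟩ := exists_mem_joinings_lt (h.trans_lt (lt_add_of_pos_right c hε))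
      exact ⟨π, h1, h2.le⟩
    · intro h
      refine le_of_forall_pos_le_add fun ε hε => ?_
      obtain ⟨π, h1, h2⟩ := h ⟨ε, hε⟩
      exact (dbar_le_integral h1).trans h2
  rw [this]
  exact isClosed_iInter fun ε => isClosed_exists_joining_le _

/-- Joint convexity of `dbar`. -/
theorem dbar_le_of_convexComb {n : ℕ} {c : Fin n → ℝ} (hc : c ∈ stdSimplex ℝ (Fin n))
    {σ τ : Fin n → InvariantProb T} {μ ν : InvariantProb T}
    (hμ : (μ.1 : Measure X) = ∑ i, ENNReal.ofReal (c i) • ((σ i).1 : Measure X))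
    (hν : (ν.1 : Measure X) = ∑ i, ENNReal.ofReal (c i) • ((τ i).1 : Measure X))
    {M : ℝ} (hM : ∀ i, dbar T (σ i) (τ i) ≤ M) : dbar T μ ν ≤ M := by
  refine le_of_forall_pos_le_add fun ε hε => ?_
  choose π hπ hle using fun i => exists_mem_joinings_lt
    (lt_of_le_of_lt (hM i) (lt_add_of_pos_right M hε))
  have hp : ∀ i, IsProbabilityMeasure (π i) := fun i => (hπ i).1
  have hsum : ∑ i, ENNReal.ofReal (c i) = 1 := by
    rw [← ENNReal.ofReal_sum_of_nonneg fun i _ => hc.1 i, hc.2, ENNReal.ofReal_one]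
  have hmap : ∀ {Y : Type u} [MeasurableSpace Y] {g : X × X → Y}, Measurable g →
      (∑ i, ENNReal.ofReal (c i) • π i).map g = ∑ i, ENNReal.ofReal (c i) • (π i).map g := by
    intro Y _ g hg
    rw [← Measure.mapₗ_apply_of_measurable hg, map_sum]
    simp only [Measure.mapₗ_apply_of_measurable hg, Measure.map_smul]
  -- The same mixture of near-optimal joinings joins the mixed marginals, and its cost is the
  -- average of the costs.
  have hmem : (∑ i, ENNReal.ofReal (c i) • π i) ∈ joinings T μ ν := by
    refine ⟨⟨by simp [hsum]⟩, ⟨by fun_prop, ?_⟩, ?_, ?_⟩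
    · rw [hmap (by fun_prop)]
      simp only [(hπ _).2.1.map_eq]
    · rw [hmap measurable_fst, hμ]
      simp only [(hπ _).2.2.1]
    · rw [hmap measurable_snd, hν]
      simp only [(hπ _).2.2.2]
  refine (dbar_le_integral hmem).trans ?_
  rw [integral_finsetSum_measure fun i _ => (integrable_dist_prod (π i)).smul_measure
    ENNReal.ofReal_ne_top]
  simp only [integral_smul_measure, ENNReal.toReal_ofReal (hc.1 _), smul_eq_mul]
  calc _ ≤ ∑ i, c i * (M + ε) :=
        Finset.sum_le_sum fun i _ => mul_le_mul_of_nonneg_left (hle i).le (hc.1 i)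
    _ = M + ε := by rw [← Finset.sum_mul, hc.2, one_mul]

theorem measurePreserving_of_integral_comp {μ : Measure X} [IsFiniteMeasure μ]
    (h : ∀ f : C(X, ℝ), ∫ x, f (T x) ∂μ = ∫ x, f x ∂μ) : MeasurePreserving T μ μ := by
  have hT : Measurable T := T.continuous.measurable
  refine ⟨hT, ext_of_forall_integral_eq_of_IsFiniteMeasure fun f => ?_⟩
  rw [integral_map hT.aemeasurable f.continuous.aestronglyMeasurable]
  exact h f.toContinuousMap

/-- **Krylov–Bogolyubov**: a homeomorphism of a nonempty compact metric space has an invariant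
probability measure. -/
theorem nonempty_invariantProb [Nonempty X] : Nonempty (InvariantProb T) := by
  obtain ⟨x₀⟩ := ‹Nonempty X›
  have hpos : ∀ n : ℕ, ((n : ℝ≥0∞) + 1) ≠ 0 := fun n => by simp
  -- Empirical measures along an orbit, over `n + 1` points so that the normalisation never divides
  -- by zero.
  let m : ℕ → ProbabilityMeasure X := fun n =>
    ⟨((n : ℝ≥0∞) + 1)⁻¹ • ∑ k ∈ Finset.range (n + 1), Measure.dirac (T^[k] x₀), ⟨by
      simp [ENNReal.inv_mul_cancel (hpos n)
        (ENNReal.add_ne_top.2 ⟨ENNReal.natCast_ne_top n, ENNReal.one_ne_top⟩)]⟩⟩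
  have hm : ∀ (f : C(X, ℝ)) (n : ℕ),
      ∫ x, f x ∂(m n : Measure X) = birkhoffAverage ℝ T f (n + 1) x₀ := by
    intro f n
    change ∫ x, f x ∂(((n : ℝ≥0∞) + 1)⁻¹ • ∑ k ∈ Finset.range (n + 1), Measure.dirac (T^[k] x₀)) = _
    rw [integral_smul_measure, integral_finsetSum_measure fun i _ =>
      ContinuousMap.integrable_of_compactSpace f.continuous _]
    simp [birkhoffAverage, birkhoffSum, ENNReal.toReal_inv, ENNReal.toReal_add]
  -- Compactness gives a limit along a free ultrafilter, with no subsequence to extract.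
  let U : Ultrafilter (ProbabilityMeasure X) := (hyperfilter ℕ).map m
  have hU : Tendsto m (hyperfilter ℕ : Filter ℕ) (𝓝 U.lim) := U.le_nhds_lim
  refine ⟨U.lim, measurePreserving_of_integral_comp fun f => ?_⟩
  have t1 := ((ProbabilityMeasure.continuous_integral_continuousMap f).tendsto _).comp hU
  have t2 := ((ProbabilityMeasure.continuous_integral_continuousMap
    (f.comp (T : C(X, X)))).tendsto _).comp hU
  -- Birkhoff averages started at `x₀` and at `T x₀` differ only in two end terms of a bounded
  -- sequence, so their difference tends to zero; this is invariance of the limit.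
  have t3 := tendsto_birkhoffAverage_apply_sub_birkhoffAverage ℝ (f := T) (g := f) (x := x₀)
    ((isCompact_range f.continuous).isBounded.subset (by
      rintro _ ⟨n, rfl⟩; exact Set.mem_range_self _))
  have t4 := ((tendsto_add_atTop_iff_nat 1).2 t3).mono_left
    (Nat.hyperfilter_le_atTop)
  have t5 := t2.sub t1
  have : ∀ n, birkhoffAverage ℝ T f (n + 1) (T x₀) =
      birkhoffAverage ℝ T (f.comp (T : C(X, X))) (n + 1) x₀ := by
    intro n
    simp only [birkhoffAverage, birkhoffSum, ContinuousMap.comp_apply, ContinuousMap.coe_coe,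
      ← Function.iterate_succ_apply, ← Function.iterate_succ_apply']
  have t6 := tendsto_nhds_unique t5 (t4.congr fun n => by
    simp only [Function.comp_apply, hm, this])
  exact sub_eq_zero.1 t6

end Topology

/-! ### The regular representation on `ℓ²(X × ℤ)` -/

section RegularRepresentation

/-- The Hilbert space `ℓ²(ι)`. -/
abbrev EllTwo (ι : Type u) : Type u := lp (fun _ : ι => ℂ) 2

section Operators

variable {ι : Type u}

theorem EllTwo.ext {v w : EllTwo ι} (h : ∀ i, v i = w i) : v = w := lp.ext (funext h)

/-- Multiplication by the bounded function `f ∘ p` on `ℓ²(ι)`. -/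
def diagonalOp {X : Type u} [TopologicalSpace X] [CompactSpace X] (p : ι → X) (f : C(X, ℂ)) :
    EllTwo ι →L[ℂ] EllTwo ι :=
  LinearMap.mkContinuous
    { toFun v := ⟨fun i => f (p i) * v i, by
        refine ((lp.memℓp v).norm.const_mul ‖f‖).mono fun i => ?_
        rw [norm_mul]
        exact mul_le_mul_of_nonneg_right (f.norm_coe_le_norm _) (norm_nonneg _)⟩
      map_add' v w := EllTwo.ext fun i => mul_add _ _ _
      map_smul' c v := EllTwo.ext fun i => mul_left_comm _ _ _ }
    ‖f‖ fun v => by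
      have h : ‖f‖ * ‖v‖ = ‖(‖f‖ : ℂ) • v‖ := by
        rw [norm_smul, Complex.norm_real, norm_norm]
      rw [h]
      refine lp.norm_mono (by norm_num) fun i => ?_
      change ‖f (p i) * v i‖ ≤ ‖(‖f‖ : ℂ) * v i‖
      rw [norm_mul, norm_mul, Complex.norm_real, norm_norm]
      exact mul_le_mul_of_nonneg_right (f.norm_coe_le_norm _) (norm_nonneg _)

theorem diagonalOp_apply {X : Type u} [TopologicalSpace X] [CompactSpace X] (p : ι → X)
    (f : C(X, ℂ)) (v : EllTwo ι) (i : ι) : diagonalOp p f v i = f (p i) * v i := rfl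

/-- The permutation of coordinates of `ℓ²(ι)` given by `e`. -/
def permutationOp (e : ι ≃ ι) : EllTwo ι →L[ℂ] EllTwo ι :=
  LinearMap.mkContinuous
    { toFun v := ⟨fun i => v (e i), by
        have h2 : (0 : ℝ) < (2 : ℝ≥0∞).toReal := by norm_num
        exact memℓp_gen (e.summable_iff.2 ((lp.memℓp v).summable h2))⟩
      map_add' v w := rfl
      map_smul' c v := rfl }
    1 fun v => by
      have h2 : (0 : ℝ) < (2 : ℝ≥0∞).toReal := by norm_num
      rw [one_mul, lp.norm_eq_tsum_rpow h2, lp.norm_eq_tsum_rpow h2]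
      exact (congrArg (· ^ (1 / (2 : ℝ≥0∞).toReal))
        (e.tsum_eq fun i => ‖v i‖ ^ (2 : ℝ≥0∞).toReal)).le

theorem permutationOp_apply (e : ι ≃ ι) (v : EllTwo ι) (i : ι) :
    permutationOp e v i = v (e i) := rfl

theorem star_diagonalOp {X : Type u} [TopologicalSpace X] [CompactSpace X] (p : ι → X)
    (f : C(X, ℂ)) : star (diagonalOp p f) = diagonalOp p (star f) := by
  rw [ContinuousLinearMap.star_eq_adjoint, eq_comm, ContinuousLinearMap.eq_adjoint_iff]
  intro v w
  rw [lp.inner_eq_tsum, lp.inner_eq_tsum]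
  refine tsum_congr fun i => ?_
  simp only [diagonalOp_apply, ContinuousMap.star_apply, RCLike.inner_apply, map_mul,
    RCLike.star_def, RCLike.conj_conj]
  ring

theorem star_permutationOp (e : ι ≃ ι) : star (permutationOp e) = permutationOp e.symm := by
  rw [ContinuousLinearMap.star_eq_adjoint, eq_comm, ContinuousLinearMap.eq_adjoint_iff]
  intro v w
  rw [lp.inner_eq_tsum, lp.inner_eq_tsum, ← e.tsum_eq]
  refine tsum_congr fun i => ?_
  simp [permutationOp_apply]

/-- The permutation of coordinates as a unitary operator. -/
def permutationUnitary (e : ι ≃ ι) : unitary (EllTwo ι →L[ℂ] EllTwo ι) :=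
  ⟨permutationOp e, by
    rw [Unitary.mem_iff, star_permutationOp]
    constructor <;> ext v : 1 <;> refine EllTwo.ext fun i => ?_ <;>
      simp [permutationOp_apply]⟩

/-- The representation of `C(X)` on `ℓ²(ι)` by diagonal operators. -/
def diagonalHom {X : Type u} [TopologicalSpace X] [CompactSpace X] (p : ι → X) :
    C(X, ℂ) →⋆ₐ[ℂ] (EllTwo ι →L[ℂ] EllTwo ι) where
  toFun := diagonalOp p
  map_one' := by ext v : 1; exact EllTwo.ext fun i => one_mul _
  map_mul' f g := by ext v : 1; exact EllTwo.ext fun i => mul_assoc _ _ _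
  map_zero' := by ext v : 1; exact EllTwo.ext fun i => zero_mul _
  map_add' f g := by ext v : 1; exact EllTwo.ext fun i => add_mul _ _ _
  commutes' r := by ext v : 1; exact EllTwo.ext fun i => rfl
  map_star' f := (star_diagonalOp p f).symm

end Operators

variable {X : Type u} [TopologicalSpace X] [CompactSpace X]

/-- The shift `(x, n) ↦ (x, n - 1)`. -/
def shiftEquiv (X : Type u) : X × ℤ ≃ X × ℤ := (Equiv.refl X).prodCongr (Equiv.subRight 1)

/-- The unit vector of `ℓ²(X × ℤ)` at `(x, 0)`. -/
def originVector (x : X) : EllTwo (X × ℤ) :=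
  open scoped Classical in lp.single 2 (x, 0) 1

theorem originVector_apply (x : X) (n : ℤ) : originVector x (x, n) = if n = 0 then 1 else 0 := by
  classical
  simp [originVector, lp.single_apply, Pi.single_apply]

theorem norm_originVector (x : X) : ‖originVector x‖ = 1 := by
  classical
  simp [originVector]

theorem inner_originVector (x : X) (v : EllTwo (X × ℤ)) :
    inner ℂ (originVector x) v = v (x, 0) := by
  classical
  rw [originVector, lp.inner_single_left]
  simp

/-- The sum over all points of `X` of the regular representations on their orbits. -/
def regularPair [Nonempty X] (T : X ≃ₜ X) : CovariantPair T where
  -- Treating all points of `X` at once needs no measure on `X`, and the algebra stays in the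
  -- universe `u` that `CovariantPair` requires.
  B := EllTwo (X × ℤ) →L[ℂ] EllTwo (X × ℤ)
  nontrivial := by
    have : Nontrivial (EllTwo (X × ℤ)) := by
      obtain ⟨x⟩ := ‹Nonempty X›
      refine ⟨originVector x, 0, fun h => ?_⟩
      have := norm_originVector x
      rw [h, norm_zero] at this
      exact zero_ne_one this
    infer_instance
  φ := diagonalHom fun p : X × ℤ => (T ^ p.2) p.1
  w := permutationUnitary (shiftEquiv X)
  covariant f := by
    ext v : 1
    refine EllTwo.ext fun ⟨x, n⟩ => ?_
    change permutationOp (shiftEquiv X) (diagonalOp _ f (star (permutationOp (shiftEquiv X)) v)) (x, n)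
      = diagonalOp _ (f.comp (T.symm : C(X, X))) v (x, n)
    rw [star_permutationOp]
    simp only [permutationOp_apply, diagonalOp_apply, Equiv.symm_apply_apply,
      ContinuousMap.comp_apply]
    -- Conjugation by the shift evaluates `f` one step earlier on the orbit of `x`, which is
    -- composition with `T⁻¹`.
    have : (T ^ (n - 1)) x = T.symm ((T ^ n) x) := by
      rw [sub_eq_add_neg, add_comm, zpow_add, zpow_neg_one]; rfl
    change f ((T ^ (n - 1)) x) * v (x, n) = f (T.symm ((T ^ n) x)) * v (x, n)
    rw [this]

theorem permutationUnitary_shiftEquiv_zpow_apply (k : ℤ) (v : EllTwo (X × ℤ)) (x : X) (n : ℤ) :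
    ((permutationUnitary (shiftEquiv X) ^ k : unitary (EllTwo (X × ℤ) →L[ℂ] EllTwo (X × ℤ))) :
      EllTwo (X × ℤ) →L[ℂ] EllTwo (X × ℤ)) v (x, n) = v (x, n - k) := by
  induction k using Int.induction_on generalizing v with
  | zero => simp
  | succ i ih =>
    rw [zpow_add_one]
    change ((permutationUnitary (shiftEquiv X) ^ (i : ℤ) : unitary _) :
      EllTwo (X × ℤ) →L[ℂ] EllTwo (X × ℤ)) (permutationOp (shiftEquiv X) v) (x, n) = _
    rw [ih]
    exact congrArg (fun m => v (x, m)) (by ring : n - (i : ℤ) - 1 = n - (i + 1))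
  | pred i ih =>
    rw [zpow_sub_one]
    change ((permutationUnitary (shiftEquiv X) ^ (-i : ℤ) : unitary _) :
      EllTwo (X × ℤ) →L[ℂ] EllTwo (X × ℤ)) (star (permutationOp (shiftEquiv X)) v) (x, n) = _
    rw [ih, star_permutationOp]
    exact congrArg (fun m => v (x, m)) (by ring : n - -(i : ℤ) + 1 = n - (-i - 1))

end RegularRepresentation

/-! ### Monomials `f u ^ n` and their dense span -/

section CrossedProductStructure

variable {X : Type u} [TopologicalSpace X] [CompactSpace X] {T : X ≃ₜ X}

/-- The canonical unitary of `C(X) ⋊_T ℤ`. -/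
def crossedProductUnitary (T : X ≃ₜ X) : unitary (CrossedProduct T) :=
  ⟨(⟨covariantProductUnitary T, StarSubalgebra.le_topologicalClosure _
      (StarAlgebra.subset_adjoin ℂ _ (Or.inr rfl))⟩ : crossedProductSubalgebra T), by
    exact Unitary.mem_iff.2
      ⟨Subtype.ext (lp.ext (funext fun π => Unitary.star_mul_self_of_mem π.w.2)),
        Subtype.ext (lp.ext (funext fun π => Unitary.mul_star_self_of_mem π.w.2))⟩⟩

/-- The universal property of `C(X) ⋊_T ℤ`: every covariant pair integrates to a
*-homomorphism. -/
def CovariantPair.lift (π : CovariantPair T) : CrossedProduct T →⋆ₐ[ℂ] π.B where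
  -- The crossed product sits inside the product over all covariant pairs, so integration is
  -- evaluation at the coordinate `π`.
  toFun a := (show CovariantProduct T from (show crossedProductSubalgebra T from a).1) π
  map_one' := rfl
  map_mul' _ _ := rfl
  map_zero' := rfl
  map_add' _ _ := rfl
  commutes' _ := rfl
  map_star' _ := rfl

theorem CovariantPair.lift_unitary_zpow (π : CovariantPair T) (n : ℤ) :
    π.lift ((crossedProductUnitary T ^ n : unitary (CrossedProduct T)) : CrossedProduct T) =
      ((π.w ^ n : unitary π.B) : π.B) := by
  have h : Unitary.map (StarMonoidHom.ofClass π.lift) (crossedProductUnitary T) = π.w := Subtype.ext rfl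
  rw [← h, ← map_zpow]
  rfl

theorem unitary_mul_incl_mul_star (f : C(X, ℂ)) :
    (crossedProductUnitary T : CrossedProduct T) * crossedProductIncl T f *
      star (crossedProductUnitary T : CrossedProduct T) =
      crossedProductIncl T (f.comp (T.symm : C(X, X))) :=
  Subtype.ext (lp.ext (funext fun π => π.covariant f))

/-- The commutation rule that makes the monomials closed under products and adjoints. -/
theorem unitary_zpow_mul_incl (n : ℤ) (f : C(X, ℂ)) :
    ((crossedProductUnitary T ^ n : unitary (CrossedProduct T)) : CrossedProduct T) *
      crossedProductIncl T f = crossedProductIncl T (f.comp ((T ^ (-n) : X ≃ₜ X) : C(X, X))) *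
      ((crossedProductUnitary T ^ n : unitary (CrossedProduct T)) : CrossedProduct T) := by
  have h1 : ∀ f : C(X, ℂ), (crossedProductUnitary T : CrossedProduct T) * crossedProductIncl T f =
      crossedProductIncl T (f.comp (T.symm : C(X, X))) *
        (crossedProductUnitary T : CrossedProduct T) := fun f => by
    rw [← unitary_mul_incl_mul_star, mul_assoc _ (star _) _,
      Unitary.star_mul_self_of_mem (crossedProductUnitary T).2, mul_one]
  have h2 : ∀ f : C(X, ℂ), star (crossedProductUnitary T : CrossedProduct T) *
      crossedProductIncl T f = crossedProductIncl T (f.comp (T : C(X, X))) *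
        star (crossedProductUnitary T : CrossedProduct T) := fun f => by
    have h3 : (f.comp (T : C(X, X))).comp (T.symm : C(X, X)) = f := by ext x; simp
    conv_lhs => rw [← h3, ← unitary_mul_incl_mul_star]
    rw [← mul_assoc, ← mul_assoc, Unitary.star_mul_self_of_mem (crossedProductUnitary T).2,
      one_mul]
  induction n using Int.induction_on generalizing f with
  | zero =>
    have : f.comp ((T ^ (-0 : ℤ) : X ≃ₜ X) : C(X, X)) = f := by ext x; simp
    rw [this]; simp
  | succ i ih =>
    rw [zpow_add_one, Submonoid.coe_mul, mul_assoc, h1, ← mul_assoc, ih, mul_assoc]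
    congr 2
    ext x
    have : T ^ (-((i : ℤ) + 1)) = T⁻¹ * T ^ (-(i : ℤ)) := by
      rw [← zpow_neg_one, ← zpow_add]; congr 1; ring
    simp only [ContinuousMap.comp_apply, this]
    rfl
  | pred i ih =>
    rw [zpow_sub_one, Submonoid.coe_mul, mul_assoc]
    change _ * (star (crossedProductUnitary T : CrossedProduct T) * _) =
      _ * (_ * star (crossedProductUnitary T : CrossedProduct T))
    rw [h2, ← mul_assoc, ih, mul_assoc]
    congr 2
    ext x
    have : T ^ (-(-(i : ℤ) - 1)) = T * T ^ (-(-(i : ℤ))) := by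
      rw [← zpow_one_add]; congr 1; ring
    simp only [ContinuousMap.comp_apply, this]
    rfl

/-- The spanning elements `f u ^ n` of the crossed product. -/
def crossedProductMonomial (T : X ≃ₜ X) (f : C(X, ℂ)) (n : ℤ) : CrossedProduct T :=
  crossedProductIncl T f *
    ((crossedProductUnitary T ^ n : unitary (CrossedProduct T)) : CrossedProduct T)

theorem crossedProductMonomial_zero (f : C(X, ℂ)) :
    crossedProductMonomial T f 0 = crossedProductIncl T f := by
  simp [crossedProductMonomial]

theorem crossedProductMonomial_one (n : ℤ) : crossedProductMonomial T 1 n =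
    ((crossedProductUnitary T ^ n : unitary (CrossedProduct T)) : CrossedProduct T) := by
  simp [crossedProductMonomial]

theorem crossedProductMonomial_mul (f g : C(X, ℂ)) (n m : ℤ) :
    crossedProductMonomial T f n * crossedProductMonomial T g m =
      crossedProductMonomial T (f * g.comp ((T ^ (-n) : X ≃ₜ X) : C(X, X))) (n + m) := by
  simp only [crossedProductMonomial]
  rw [zpow_add, Submonoid.coe_mul, map_mul, mul_assoc, ← mul_assoc _ (crossedProductIncl T g),
    unitary_zpow_mul_incl]
  simp only [mul_assoc]

theorem star_crossedProductMonomial (f : C(X, ℂ)) (n : ℤ) :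
    star (crossedProductMonomial T f n) =
      crossedProductMonomial T ((star f).comp ((T ^ n : X ≃ₜ X) : C(X, X))) (-n) := by
  have h : star ((crossedProductUnitary T ^ n : unitary (CrossedProduct T)) : CrossedProduct T) =
      ((crossedProductUnitary T ^ (-n) : unitary (CrossedProduct T)) : CrossedProduct T) := by
    rw [zpow_neg]; rfl
  simp only [crossedProductMonomial]
  rw [star_mul, h, ← map_star, unitary_zpow_mul_incl, neg_neg]

/-- The span of the elements `f u ^ n`. -/
def crossedProductSpan (T : X ≃ₜ X) : Submodule ℂ (CrossedProduct T) :=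
  Submodule.span ℂ (Set.range fun p : C(X, ℂ) × ℤ => crossedProductMonomial T p.1 p.2)

theorem crossedProductMonomial_mem (f : C(X, ℂ)) (n : ℤ) :
    crossedProductMonomial T f n ∈ crossedProductSpan T := Submodule.subset_span ⟨(f, n), rfl⟩

theorem mul_mem_crossedProductSpan {a b : CrossedProduct T} (ha : a ∈ crossedProductSpan T)
    (hb : b ∈ crossedProductSpan T) : a * b ∈ crossedProductSpan T := by
  have h := Submodule.mul_mem_mul ha hb
  rw [crossedProductSpan, Submodule.span_mul_span] at h
  refine Submodule.span_le.2 ?_ h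
  rintro _ ⟨_, ⟨⟨f, n⟩, rfl⟩, _, ⟨⟨g, m⟩, rfl⟩, rfl⟩
  simp only [crossedProductMonomial_mul]
  exact crossedProductMonomial_mem _ _

theorem star_mem_crossedProductSpan {a : CrossedProduct T} (ha : a ∈ crossedProductSpan T) :
    star a ∈ crossedProductSpan T := by
  induction ha using Submodule.span_induction with
  | mem x hx =>
    obtain ⟨⟨f, n⟩, rfl⟩ := hx
    rw [star_crossedProductMonomial]
    exact crossedProductMonomial_mem _ _
  | zero => rw [star_zero]; exact zero_mem _
  | add x y _ _ hx hy => rw [star_add]; exact add_mem hx hy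
  | smul c x _ hx => rw [star_smul]; exact Submodule.smul_mem _ _ hx

/-- The span is a *-algebra containing the generators, hence contains the algebra they generate,
which is dense by construction. -/
theorem dense_crossedProductSpan : Dense (crossedProductSpan T : Set (CrossedProduct T)) := by
  have key : ∀ x (hx : x ∈ StarAlgebra.adjoin ℂ
      (Set.range (covariantProductHom T) ∪ {covariantProductUnitary T})),
      (show CrossedProduct T from (⟨x, StarSubalgebra.le_topologicalClosure _ hx⟩ :
        crossedProductSubalgebra T)) ∈ crossedProductSpan T := by
    intro x hx
    induction hx using StarAlgebra.adjoin_induction with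
    | mem x hx =>
      rcases hx with ⟨f, rfl⟩ | rfl
      · have := crossedProductMonomial_mem (T := T) f 0
        rw [crossedProductMonomial_zero] at this
        exact this
      · have := crossedProductMonomial_mem (T := T) 1 1
        rw [crossedProductMonomial_one, zpow_one] at this
        exact this
    | algebraMap r =>
      have := crossedProductMonomial_mem (T := T) (algebraMap ℂ _ r) 0
      rw [crossedProductMonomial_zero, AlgHomClass.commutes] at this
      exact this
    | add x y _ _ hx hy => exact add_mem hx hy
    | mul x y _ _ hx hy => exact mul_mem_crossedProductSpan hx hy
    | star x _ hx => exact star_mem_crossedProductSpan hx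
  intro a
  refine Metric.mem_closure_iff.2 fun ε hε => ?_
  obtain ⟨b, hb, h⟩ := Metric.mem_closure_iff.1
    (show crossedProductSubalgebra T from a).2 ε hε
  exact ⟨_, key b hb, h⟩

/-- The induction principle for the crossed product: closed linear conditions need checking only on
monomials. -/
theorem mem_of_crossedProductMonomial_mem {S : Submodule ℂ (CrossedProduct T)}
    (hS : IsClosed (S : Set (CrossedProduct T)))
    (h : ∀ f n, crossedProductMonomial T f n ∈ S) (a : CrossedProduct T) : a ∈ S := by
  have h1 : crossedProductSpan T ≤ S := Submodule.span_le.2 (by rintro _ ⟨⟨f, n⟩, rfl⟩; exact h f n)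
  exact closure_minimal h1 hS (dense_crossedProductSpan a)

theorem crossedProduct_clm_ext {F : Type*} [NormedAddCommGroup F] [NormedSpace ℂ F]
    {L₁ L₂ : CrossedProduct T →L[ℂ] F}
    (h : ∀ f n, L₁ (crossedProductMonomial T f n) = L₂ (crossedProductMonomial T f n)) :
    L₁ = L₂ := by
  ext a
  have := mem_of_crossedProductMonomial_mem (S := (L₁ - L₂).ker)
    (L₁ - L₂).isClosed_ker (fun f n => by simp [h]) a
  simpa [sub_eq_zero] using this

theorem continuous_crossedProductIncl : Continuous (crossedProductIncl T) :=
  AddMonoidHomClass.continuous_of_bound (crossedProductIncl T) 1 fun f => by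
    rw [one_mul]
    exact NonUnitalStarAlgHom.norm_apply_le (crossedProductIncl T) f

/-- For each of the countably many `n`, the monomials `f u ^ n` form a continuous image of the
separable space `C(X)`. -/
theorem separableSpace_crossedProduct {X : Type u} [MetricSpace X] [CompactSpace X] (T : X ≃ₜ X) :
    TopologicalSpace.SeparableSpace (CrossedProduct T) := by
  have hs : TopologicalSpace.IsSeparable
      (Set.range fun p : C(X, ℂ) × ℤ => crossedProductMonomial T p.1 p.2) := by
    have : (Set.range fun p : C(X, ℂ) × ℤ => crossedProductMonomial T p.1 p.2) =
        ⋃ n : ℤ, Set.range fun f : C(X, ℂ) => crossedProductMonomial T f n := by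
      ext a; simp only [Set.mem_range, Set.mem_iUnion, Prod.exists]; exact exists_comm
    rw [this]
    refine TopologicalSpace.IsSeparable.iUnion fun n => TopologicalSpace.isSeparable_range ?_
    exact continuous_crossedProductIncl.mul continuous_const
  have h2 := (hs.span (R := ℂ)).closure
  have h3 : closure (crossedProductSpan T : Set (CrossedProduct T)) = Set.univ :=
    dense_crossedProductSpan.closure_eq
  rw [crossedProductSpan] at h3
  rw [h3] at h2
  exact TopologicalSpace.isSeparable_univ_iff.1 h2

end CrossedProductStructure

/-! ### The conditional expectation onto `C(X)` -/

section ConditionalExpectation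

variable {X : Type u} [TopologicalSpace X] [CompactSpace X] [Nonempty X] {T : X ≃ₜ X}

/-- The action of the crossed product on `ℓ²(X × ℤ)`. -/
def regularRep (T : X ≃ₜ X) :
    CrossedProduct T →⋆ₐ[ℂ] (EllTwo (X × ℤ) →L[ℂ] EllTwo (X × ℤ)) :=
  (regularPair T).lift

theorem regularRep_incl (f : C(X, ℂ)) : regularRep T (crossedProductIncl T f) =
    diagonalOp (fun p : X × ℤ => (T ^ p.2) p.1) f := rfl

theorem regularRep_unitary_zpow (n : ℤ) :
    regularRep T ((crossedProductUnitary T ^ n : unitary (CrossedProduct T)) : CrossedProduct T) =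
      ((permutationUnitary (shiftEquiv X) ^ n : unitary (EllTwo (X × ℤ) →L[ℂ] EllTwo (X × ℤ))) :
        EllTwo (X × ℤ) →L[ℂ] EllTwo (X × ℤ)) :=
  (regularPair T).lift_unitary_zpow n

/-- The values of the canonical conditional expectation `C(X) ⋊_T ℤ → C(X)`. -/
def expectationAt (T : X ≃ₜ X) (a : CrossedProduct T) (x : X) : ℂ :=
  regularRep T a (originVector x) (x, 0)

theorem expectationAt_add (a b : CrossedProduct T) (x : X) :
    expectationAt T (a + b) x = expectationAt T a x + expectationAt T b x := by
  simp [expectationAt]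

theorem expectationAt_smul (c : ℂ) (a : CrossedProduct T) (x : X) :
    expectationAt T (c • a) x = c * expectationAt T a x := by
  simp [expectationAt]

theorem norm_expectationAt_le (a : CrossedProduct T) (x : X) : ‖expectationAt T a x‖ ≤ ‖a‖ := by
  calc ‖expectationAt T a x‖ ≤ ‖regularRep T a (originVector x)‖ :=
        lp.norm_apply_le_norm (by norm_num) _ _
    _ ≤ ‖regularRep T a‖ * ‖originVector x‖ := ContinuousLinearMap.le_opNorm _ _
    _ ≤ ‖a‖ := by
        rw [norm_originVector, mul_one]
        exact NonUnitalStarAlgHom.norm_apply_le (regularRep T) a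

/-- The value is the squared norm of the vector obtained by applying `a` to the unit vector at `(x,
0)`. -/
theorem expectationAt_star_mul_self_nonneg (a : CrossedProduct T) (x : X) :
    0 ≤ expectationAt T (star a * a) x := by
  rw [expectationAt, ← inner_originVector, map_mul, map_star, mul_apply_eq_comp,
    ContinuousLinearMap.star_eq_adjoint, ContinuousLinearMap.adjoint_inner_right,
    inner_self_eq_norm_sq_to_K]
  exact pow_nonneg (Complex.zero_le_real.2 (norm_nonneg (regularRep T a (originVector x)))) 2

theorem expectationAt_monomial (f : C(X, ℂ)) (n : ℤ) (x : X) :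
    expectationAt T (crossedProductMonomial T f n) x = if n = 0 then f x else 0 := by
  have h : regularRep T (crossedProductMonomial T f n) =
      diagonalOp (fun p : X × ℤ => (T ^ p.2) p.1) f *
        ((permutationUnitary (shiftEquiv X) ^ n : unitary (EllTwo (X × ℤ) →L[ℂ] EllTwo (X × ℤ))) :
          EllTwo (X × ℤ) →L[ℂ] EllTwo (X × ℤ)) := by
    rw [crossedProductMonomial, map_mul, regularRep_incl, regularRep_unitary_zpow]
  rw [expectationAt, h, mul_apply_eq_comp, diagonalOp_apply,
    permutationUnitary_shiftEquiv_zpow_apply, originVector_apply]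
  simp

/-- A matrix coefficient on `ℓ²(X × ℤ)` does not see the topology of `X`. Continuity in `x` is
visible on monomials and passes to norm limits because `norm_expectationAt_le` is uniform in `x`. -/
theorem continuous_expectationAt (a : CrossedProduct T) : Continuous (expectationAt T a) := by
  let S : Submodule ℂ (CrossedProduct T) :=
    { carrier := {a | Continuous (expectationAt T a)}
      add_mem' := fun {a b} ha hb => by
        have : expectationAt T (a + b) = expectationAt T a + expectationAt T b :=
          funext (expectationAt_add a b)
        change Continuous _
        rw [this]
        exact Continuous.add ha hb
      zero_mem' := by
        have : expectationAt T 0 = fun _ => 0 := by ext x; simp [expectationAt]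
        change Continuous _
        rw [this]
        exact continuous_const
      smul_mem' := fun c a ha => by
        have : expectationAt T (c • a) = fun x => c * expectationAt T a x :=
          funext (expectationAt_smul c a)
        change Continuous _
        rw [this]
        exact Continuous.mul continuous_const ha }
  refine mem_of_crossedProductMonomial_mem (S := S) ?_ (fun f n => ?_) a
  · refine isClosed_of_closure_subset fun a ha => ?_
    refine continuous_of_uniform_approx_of_continuous fun V hV => ?_
    obtain ⟨ε, hε, hV⟩ := Metric.mem_uniformity_dist.1 hV
    obtain ⟨b, hb, hab⟩ := Metric.mem_closure_iff.1 ha ε hε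
    refine ⟨expectationAt T b, hb, fun x => hV ?_⟩
    refine lt_of_le_of_lt ?_ hab
    rw [dist_eq_norm, dist_eq_norm]
    have : expectationAt T a x - expectationAt T b x = expectationAt T (a - b) x := by
      simp [expectationAt]
    rw [this]
    exact norm_expectationAt_le _ _
  · change Continuous _
    rw [funext (expectationAt_monomial f n)]
    split_ifs
    · exact f.continuous
    · exact continuous_const

instance : Nontrivial (CrossedProduct T) := by
  refine ⟨⟨1, 0, fun h => ?_⟩⟩
  obtain ⟨x⟩ := ‹Nonempty X›
  have h1 := expectationAt_monomial (T := T) 1 0 x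
  rw [crossedProductMonomial_zero, map_one, h] at h1
  simp [expectationAt] at h1

end ConditionalExpectation

/-! ### From invariant measures to traces -/

section TracesOfMeasures

variable {X : Type u} [MetricSpace X] [CompactSpace X] [Nonempty X] [MeasurableSpace X]
  [BorelSpace X] {T : X ≃ₜ X}

theorem integrable_expectationAt (μ : Measure X) [IsFiniteMeasure μ] (a : CrossedProduct T) :
    Integrable (expectationAt T a) μ :=
  ContinuousMap.integrable_of_compactSpace (continuous_expectationAt a) μ

theorem norm_integral_expectationAt_le (μ : ProbabilityMeasure X) (a : CrossedProduct T) :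
    ‖∫ x, expectationAt T a x ∂(μ : Measure X)‖ ≤ ‖a‖ := by
  refine (norm_integral_le_of_norm_le_const (C := ‖a‖)
    (.of_forall fun x => norm_expectationAt_le a x)).trans ?_
  simp

/-- The functional `a ↦ ∫ E(a) dμ` on the crossed product. -/
def measureFunctional (T : X ≃ₜ X) (μ : ProbabilityMeasure X) : StrongDual ℂ (CrossedProduct T) :=
  LinearMap.mkContinuous
    { toFun a := ∫ x, expectationAt T a x ∂(μ : Measure X)
      map_add' a b := by
        simp only [expectationAt_add]
        exact integral_add (integrable_expectationAt _ a) (integrable_expectationAt _ b)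
      map_smul' c a := by
        simp only [expectationAt_smul]
        exact integral_const_mul _ _ }
    1 fun a => by
      rw [one_mul]
      exact norm_integral_expectationAt_le μ a

theorem measureFunctional_apply (μ : ProbabilityMeasure X) (a : CrossedProduct T) :
    measureFunctional T μ a = ∫ x, expectationAt T a x ∂(μ : Measure X) := rfl

theorem measureFunctional_monomial (μ : ProbabilityMeasure X) (f : C(X, ℂ)) (n : ℤ) :
    measureFunctional T μ (crossedProductMonomial T f n) =
      if n = 0 then ∫ x, f x ∂(μ : Measure X) else 0 := by
  rw [measureFunctional_apply]
  simp only [expectationAt_monomial]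
  split_ifs <;> simp

theorem measureFunctional_incl (μ : ProbabilityMeasure X) (f : C(X, ℂ)) :
    measureFunctional T μ (crossedProductIncl T f) = ∫ x, f x ∂(μ : Measure X) := by
  rw [← crossedProductMonomial_zero, measureFunctional_monomial, if_pos rfl]

theorem measurePreserving_zpow (μ : InvariantProb T) (n : ℤ) :
    MeasurePreserving (T ^ n : X ≃ₜ X) (μ.1 : Measure X) (μ.1 : Measure X) := by
  have h1 : MeasurePreserving (T⁻¹ : X ≃ₜ X) (μ.1 : Measure X) (μ.1 : Measure X) :=
    MeasurePreserving.symm T.toMeasurableEquiv μ.2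
  induction n using Int.induction_on with
  | zero => exact MeasurePreserving.id _
  | succ i ih => rw [zpow_add_one]; exact ih.comp μ.2
  | pred i ih => rw [zpow_sub_one]; exact ih.comp h1

theorem measureFunctional_mul_comm (μ : InvariantProb T) (a b : CrossedProduct T) :
    measureFunctional T μ.1 (a * b) = measureFunctional T μ.1 (b * a) := by
  have gen : ∀ (f g : C(X, ℂ)) (n m : ℤ),
      measureFunctional T μ.1 (crossedProductMonomial T f n * crossedProductMonomial T g m) =
      measureFunctional T μ.1 (crossedProductMonomial T g m * crossedProductMonomial T f n) := by
    intro f g n m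
    rw [crossedProductMonomial_mul, crossedProductMonomial_mul, measureFunctional_monomial,
      measureFunctional_monomial, add_comm m n]
    split_ifs with h
    -- Only opposite exponents contribute; invariance under `T ^ n` then matches the two integrals.
    · obtain rfl : m = -n := by omega
      rw [← (measurePreserving_zpow μ n).integral_comp (T ^ n : X ≃ₜ X).measurableEmbedding]
      refine integral_congr_ae (.of_forall fun x => ?_)
      simp [mul_comm]
    · rfl
  let L := measureFunctional T μ.1
  -- The identity extends by density one factor at a time, the first factor before the second.
  have h1 : ∀ g m, L ∘L (ContinuousLinearMap.mul ℂ _).flip (crossedProductMonomial T g m) =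
      L ∘L ContinuousLinearMap.mul ℂ _ (crossedProductMonomial T g m) := fun g m =>
    crossedProduct_clm_ext fun f n => gen f g n m
  have h2 : L ∘L ContinuousLinearMap.mul ℂ _ a = L ∘L (ContinuousLinearMap.mul ℂ _).flip a :=
    crossedProduct_clm_ext fun g m => DFunLike.congr_fun (h1 g m) a
  exact DFunLike.congr_fun h2 b

theorem measureFunctional_mem_tracialStates (μ : InvariantProb T) :
    StrongDual.toWeakDual (measureFunctional T μ.1) ∈ tracialStates (CrossedProduct T) := by
  have hone : measureFunctional T μ.1 (1 : CrossedProduct T) = 1 := by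
    rw [← map_one (crossedProductIncl T), measureFunctional_incl]
    simp
  refine ⟨fun a => ?_, le_antisymm (ContinuousLinearMap.opNorm_le_bound _ zero_le_one
    fun a => (norm_integral_expectationAt_le μ.1 a).trans_eq (one_mul _).symm) ?_, hone,
    fun a w => ?_⟩
  · change 0 ≤ ∫ x, expectationAt T (star a * a) x ∂(μ.1 : Measure X)
    have h : ∀ x, expectationAt T (star a * a) x = ((expectationAt T (star a * a) x).re : ℂ) :=
      fun x => Complex.eq_re_of_ofReal_le (r := 0)
        (by simpa using expectationAt_star_mul_self_nonneg a x)
    rw [integral_congr_ae (.of_forall h), integral_complex_ofReal]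
    have : 0 ≤ ∫ x, (expectationAt T (star a * a) x).re ∂(μ.1 : Measure X) :=
      integral_nonneg fun x => (Complex.nonneg_iff.1 (expectationAt_star_mul_self_nonneg a x)).1
    exact_mod_cast this
  · have := (measureFunctional T μ.1).le_opNorm (1 : CrossedProduct T)
    rw [hone, norm_one, CStarRing.norm_one, mul_one] at this
    exact this
  · change measureFunctional T μ.1 ((w : CrossedProduct T) * a * star (w : CrossedProduct T)) =
      measureFunctional T μ.1 a
    rw [measureFunctional_mul_comm, ← mul_assoc, Unitary.star_mul_self_of_mem w.2, one_mul]

/-- The trace `a ↦ ∫ E(a) dμ` of an invariant measure `μ`. -/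
def traceOfMeasure (μ : InvariantProb T) : TraceSpace (CrossedProduct T) :=
  ⟨_, measureFunctional_mem_tracialStates μ⟩

/-- Evaluation at `a` is integration of the continuous function `E(a)`. It is split into real and
imaginary parts because weak convergence of measures is tested on real functions. -/
theorem continuous_traceOfMeasure : Continuous (traceOfMeasure (T := T)) := by
  refine Continuous.subtype_mk (WeakDual.continuous_of_continuous_eval fun a => ?_) _
  have hc := continuous_expectationAt a
  have hi : ∀ μ : InvariantProb T, ∫ x, expectationAt T a x ∂(μ.1 : Measure X) =
      ((∫ x, (expectationAt T a x).re ∂(μ.1 : Measure X) : ℝ) : ℂ) +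
      ((∫ x, (expectationAt T a x).im ∂(μ.1 : Measure X) : ℝ) : ℂ) * Complex.I := fun μ =>
    (integral_re_add_im (integrable_expectationAt (μ.1 : Measure X) a)).symm
  change Continuous fun μ : InvariantProb T => ∫ x, expectationAt T a x ∂(μ.1 : Measure X)
  simp only [hi]
  have k : ∀ f : C(X, ℝ), Continuous fun μ : InvariantProb T => ∫ x, f x ∂(μ.1 : Measure X) :=
    fun f => (ProbabilityMeasure.continuous_integral_continuousMap f).comp continuous_subtype_val
  have k1 := k ⟨fun x => (expectationAt T a x).re, by fun_prop⟩
  have k2 := k ⟨fun x => (expectationAt T a x).im, by fun_prop⟩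
  simp only [ContinuousMap.coe_mk] at k1 k2
  fun_prop

end TracesOfMeasures

/-! ### From traces to invariant measures -/

section MeasuresOfTraces

/-- Riesz representation of positive unital functionals on `C(X, ℂ)`. -/
theorem exists_probabilityMeasure_of_positive {X : Type u} [MetricSpace X] [CompactSpace X]
    [MeasurableSpace X] [BorelSpace X] (L : C(X, ℂ) →ₗ[ℂ] ℂ) (h1 : L 1 = 1)
    (hpos : ∀ g, 0 ≤ L (star g * g)) :
    ∃ μ : ProbabilityMeasure X, ∀ f : C(X, ℂ), L f = ∫ x, f x ∂(μ : Measure X) := by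
  let c : C(X, ℝ) → C(X, ℂ) := fun f => ⟨fun x => (f x : ℂ), by fun_prop⟩
  have hc : ∀ f : C(X, ℝ), (∀ x, 0 ≤ f x) → 0 ≤ L (c f) := by
    intro f hf
    -- A nonnegative function is `g* g` for its square root `g`.
    have : c f = star (c ⟨fun x => √(f x), by fun_prop⟩) * c ⟨fun x => √(f x), by fun_prop⟩ := by
      ext x
      simp only [c, ContinuousMap.coe_mk, ContinuousMap.mul_apply, ContinuousMap.star_apply,
        RCLike.star_def, Complex.conj_ofReal, ← Complex.ofReal_mul, Real.mul_self_sqrt (hf x)]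
    rw [this]
    exact hpos _
  have him : ∀ f : C(X, ℝ), (L (c f)).im = 0 := by
    intro f
    -- Adding the constant `‖f‖` makes `f` nonnegative and changes the functional by a real number
    -- only.
    have h2 := (Complex.nonneg_iff.1 (hc (f + algebraMap ℝ C(X, ℝ) ‖f‖) fun x => by
      have := neg_le_of_abs_le (f.norm_coe_le_norm x)
      change 0 ≤ f x + ‖f‖
      linarith)).2
    have h3 : c (f + algebraMap ℝ C(X, ℝ) ‖f‖) = c f + (‖f‖ : ℂ) • 1 := by
      ext x
      change ((f x + ‖f‖ : ℝ) : ℂ) = f x + ‖f‖ * 1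
      push_cast; ring
    rw [h3, map_add, map_smul, h1] at h2
    simpa using h2.symm
  let Λ : CompactlySupportedContinuousMap X ℝ →ₚ[ℝ] ℝ := PositiveLinearMap.mk₀
    { toFun f := (L (c f.toContinuousMap)).re
      map_add' f g := by
        have : c (f + g).toContinuousMap = c f.toContinuousMap + c g.toContinuousMap := by
          ext x; simp [c]
        rw [this, map_add, Complex.add_re]
      map_smul' r f := by
        have : c (r • f).toContinuousMap = (r : ℂ) • c f.toContinuousMap := by
          ext x; simp [c]
        rw [this, map_smul]
        simp }
    fun f hf => (Complex.nonneg_iff.1 (hc _ fun x => hf x)).1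
  have hΛ : ∀ f : C(X, ℝ), ((∫ x, f x ∂(RealRMK.rieszMeasure Λ) : ℝ) : ℂ) = L (c f) := by
    intro f
    have := RealRMK.integral_rieszMeasure Λ ⟨f, HasCompactSupport.of_compactSpace f⟩
    apply Complex.ext
    · rw [Complex.ofReal_re]; exact this
    · rw [him, Complex.ofReal_im]
  have hprob : IsProbabilityMeasure (RealRMK.rieszMeasure Λ) := by
    have h2 := hΛ 1
    have h3 : c 1 = 1 := by ext x; simp [c]
    rw [h3, h1] at h2
    simp only [ContinuousMap.one_apply, integral_const, smul_eq_mul, mul_one,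
      Complex.ofReal_eq_one] at h2
    exact ⟨(ENNReal.toReal_eq_one_iff _).1 h2⟩
  refine ⟨⟨RealRMK.rieszMeasure Λ, hprob⟩, fun f => ?_⟩
  change L f = ∫ x, f x ∂(RealRMK.rieszMeasure Λ)
  have h4 := integral_re_add_im
    (ContinuousMap.integrable_of_compactSpace f.continuous (RealRMK.rieszMeasure Λ))
  have h5 := hΛ ⟨fun x => (f x).re, by fun_prop⟩
  have h6 := hΛ ⟨fun x => (f x).im, by fun_prop⟩
  have h7 : f = c ⟨fun x => (f x).re, by fun_prop⟩ +
      Complex.I • c ⟨fun x => (f x).im, by fun_prop⟩ := by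
    ext x
    simp only [c, ContinuousMap.add_apply, ContinuousMap.smul_apply, ContinuousMap.coe_mk,
      smul_eq_mul]
    rw [mul_comm, Complex.re_add_im]
  rw [← h4]
  conv_lhs => rw [h7, map_add, map_smul, ← h5, ← h6, smul_eq_mul, mul_comm]
  rfl

/-- Unitary invariance applied to `b * w` gives the trace identity for a unitary `w`, and the
unitaries span the algebra. -/
theorem tracialState_mul_comm {A : Type v} [CStarAlgebra A] (τ : TraceSpace A) (a b : A) :
    (τ : WeakDual ℂ A) (a * b) = (τ : WeakDual ℂ A) (b * a) := by
  have hu : ∀ w : unitary A, (τ : WeakDual ℂ A) ((w : A) * b) = (τ : WeakDual ℂ A) (b * w) := by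
    intro w
    have := τ.2.2.2.2 (b * w) w
    rwa [mul_assoc, mul_assoc, Unitary.mul_star_self_of_mem w.2, mul_one] at this
  have ha : a ∈ Submodule.span ℂ (unitary A : Set A) := by
    rw [CStarAlgebra.span_unitary]; trivial
  induction ha using Submodule.span_induction with
  | mem x hx => exact hu ⟨x, hx⟩
  | zero => simp
  | add x y _ _ hx hy => rw [add_mul, mul_add, map_add, map_add, hx, hy]
  | smul c x _ hx => rw [smul_mul_assoc, mul_smul_comm, map_smul, map_smul, hx]

variable {X : Type u} [MetricSpace X] [CompactSpace X] {T : X ≃ₜ X}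

/-- Traces of the crossed product of a free homeomorphism vanish off the diagonal. -/
theorem trace_monomial_eq_zero (hT : IsFreeHomeo T) (τ : TraceSpace (CrossedProduct T))
    (f : C(X, ℂ)) {n : ℤ} (hn : n ≠ 0) :
    (τ : WeakDual ℂ (CrossedProduct T)) (crossedProductMonomial T f n) = 0 := by
  let t : StrongDual ℂ (CrossedProduct T) := WeakDual.toStrongDual (τ : WeakDual ℂ (CrossedProduct T))
  have hcont : Continuous fun f : C(X, ℂ) => t (crossedProductMonomial T f n) :=
    t.continuous.comp (continuous_crossedProductIncl.mul continuous_const)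
  have hadd : ∀ f g : C(X, ℂ), t (crossedProductMonomial T (f + g) n) =
      t (crossedProductMonomial T f n) + t (crossedProductMonomial T g n) := by
    intro f g
    rw [← map_add, crossedProductMonomial, map_add, add_mul]; rfl
  -- A closed ideal of `C(X)` with no common zero is everything, so it is enough to find, for each
  -- `x`, a member that does not vanish at `x`.
  let I : Ideal C(X, ℂ) :=
    { carrier := {f | ∀ g : C(X, ℂ), t (crossedProductMonomial T (f * g) n) = 0}
      add_mem' := fun {f g} hf hg k => by rw [add_mul, hadd, hf k, hg k, add_zero]
      zero_mem' := fun k => by simp [crossedProductMonomial]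
      smul_mem' := fun g f hf k => by
        rw [smul_eq_mul, mul_comm g f, mul_assoc]; exact hf _ }
  have hI : IsClosed (I : Set C(X, ℂ)) := by
    have : (I : Set C(X, ℂ)) = ⋂ g : C(X, ℂ), {f | t (crossedProductMonomial T (f * g) n) = 0} := by
      ext f; simp [I]
    rw [this]
    exact isClosed_iInter fun g =>
      isClosed_eq (hcont.comp (continuous_id.mul continuous_const)) continuous_const
  have hset : ContinuousMap.setOfIdeal I = Set.univ := by
    refine Set.eq_univ_of_forall fun x => ContinuousMap.mem_setOfIdeal.2 ?_
    let S : X ≃ₜ X := T ^ (-n)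
    have hd : 0 < dist (S x) x := dist_pos.2 (hT (-n) (neg_ne_zero.2 hn) x)
    -- With `d = dist (S x) x`, the bump `k₁` lives where `y` is within `d / 2` of `x`, and `k₂`
    -- where `S y` is within `d / 2` of `S x`. A point with `k₂ y` and `k₁ (S y)` both nonzero would
    -- have `S y` in two disjoint balls.
    let k₁ : C(X, ℂ) := ⟨fun y => ((max 0 (dist (S x) x / 2 - dist y x) : ℝ) : ℂ), by fun_prop⟩
    let k₂ : C(X, ℂ) :=
      ⟨fun y => ((max 0 (dist (S x) x / 2 - dist (S y) (S x)) : ℝ) : ℂ), by fun_prop⟩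
    have h0 : k₂ * k₁.comp (S : C(X, X)) = 0 := by
      ext y
      simp only [k₁, k₂, ContinuousMap.mul_apply, ContinuousMap.comp_apply, ContinuousMap.coe_mk,
        ContinuousMap.zero_apply, mul_eq_zero, Complex.ofReal_eq_zero,
        max_eq_left_iff]
      by_contra! h
      have := dist_triangle_left (S x) x (S y)
      linarith [h.1, h.2]
    refine ⟨k₁ * k₂, fun g => ?_, ?_⟩
    -- The trace property carries `k₁` to the right end; passing it back through `u ^ n` turns it
    -- into `k₁ ∘ S`, which `k₂` annihilates.
    · have e1 : crossedProductMonomial T (k₁ * k₂ * g) n =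
          crossedProductIncl T k₁ * crossedProductMonomial T (k₂ * g) n := by
        simp only [crossedProductMonomial, map_mul, mul_assoc]
      have e2 : t (crossedProductIncl T k₁ * crossedProductMonomial T (k₂ * g) n) =
          t (crossedProductMonomial T (k₂ * g) n * crossedProductIncl T k₁) :=
        tracialState_mul_comm τ _ _
      rw [e1, e2, ← crossedProductMonomial_zero, crossedProductMonomial_mul, mul_right_comm, h0,
        zero_mul]
      simp [crossedProductMonomial]
    · have : (k₁ * k₂) x = ((dist (S x) x / 2 : ℝ) : ℂ) * ((dist (S x) x / 2 : ℝ) : ℂ) := by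
        simp [k₁, k₂, max_eq_right (half_pos hd).le]
      rw [this, ← Complex.ofReal_mul, Ne, Complex.ofReal_eq_zero]
      positivity
  have htop : (1 : C(X, ℂ)) ∈ I := by
    have h := ContinuousMap.idealOfSet_ofIdeal_isClosed hI
    rw [hset] at h
    rw [← h]
    exact fun x hx => absurd trivial hx
  have := htop f
  rwa [one_mul] at this

variable [MeasurableSpace X] [BorelSpace X]

theorem exists_invariantProb_of_trace (τ : TraceSpace (CrossedProduct T)) :
    ∃ μ : InvariantProb T, ∀ f : C(X, ℂ),
      (τ : WeakDual ℂ (CrossedProduct T)) (crossedProductIncl T f) =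
        ∫ x, f x ∂(μ.1 : Measure X) := by
  let t : StrongDual ℂ (CrossedProduct T) := WeakDual.toStrongDual (τ : WeakDual ℂ (CrossedProduct T))
  obtain ⟨μ, hμ⟩ := exists_probabilityMeasure_of_positive
    ((t : CrossedProduct T →ₗ[ℂ] ℂ) ∘ₗ (crossedProductIncl T).toAlgHom.toLinearMap)
    (by change t (crossedProductIncl T 1) = 1; rw [map_one]; exact τ.2.2.2.1)
    (fun g => by
      change 0 ≤ t (crossedProductIncl T (star g * g))
      rw [map_mul, map_star]; exact τ.2.1 _)
  have hμ' : ∀ f : C(X, ℂ), t (crossedProductIncl T f) = ∫ x, f x ∂(μ : Measure X) := hμ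
  refine ⟨⟨μ, measurePreserving_of_integral_comp fun f => ?_⟩, hμ'⟩
  let cf : C(X, ℂ) := ⟨fun x => (f x : ℂ), by fun_prop⟩
  -- Conjugating `f ∘ T` by `u` returns `f`, so unitary invariance of the trace is `T`-invariance of
  -- the measure.
  have h1 := τ.2.2.2.2 (crossedProductIncl T (cf.comp (T : C(X, X)))) (crossedProductUnitary T)
  rw [unitary_mul_incl_mul_star] at h1
  have h2 : (cf.comp (T : C(X, X))).comp (T.symm : C(X, X)) = cf := by ext x; simp
  rw [h2] at h1
  have h3 := ((hμ' cf).symm.trans h1).trans (hμ' _)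
  simp only [cf, ContinuousMap.comp_apply, ContinuousMap.coe_mk, integral_complex_ofReal] at h3
  exact_mod_cast h3.symm

/-- The invariant measure `μ_τ` with `τ(f) = ∫ f dμ_τ`. -/
def measureOfTrace (τ : TraceSpace (CrossedProduct T)) : InvariantProb T :=
  (exists_invariantProb_of_trace τ).choose

theorem trace_incl_eq_integral (τ : TraceSpace (CrossedProduct T)) (f : C(X, ℂ)) :
    (τ : WeakDual ℂ (CrossedProduct T)) (crossedProductIncl T f) =
      ∫ x, f x ∂((measureOfTrace τ).1 : Measure X) :=
  (exists_invariantProb_of_trace τ).choose_spec f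

theorem continuous_measureOfTrace : Continuous (measureOfTrace (T := T)) := by
  refine continuous_induced_rng.2
    (ProbabilityMeasure.continuous_iff_forall_continuousMap_continuous_integral.2 fun f => ?_)
  let cf : C(X, ℂ) := ⟨fun x => (f x : ℂ), by fun_prop⟩
  have h : ∀ τ : TraceSpace (CrossedProduct T), ∫ x, f x ∂((measureOfTrace τ).1 : Measure X) =
      ((τ : WeakDual ℂ (CrossedProduct T)) (crossedProductIncl T cf)).re := by
    intro τ
    rw [trace_incl_eq_integral]
    simp only [cf, ContinuousMap.coe_mk, integral_complex_ofReal, Complex.ofReal_re]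
  change Continuous fun τ : TraceSpace (CrossedProduct T) =>
    ∫ x, f x ∂((measureOfTrace τ).1 : Measure X)
  simp only [h]
  exact Complex.continuous_re.comp
    ((WeakDual.eval_continuous (crossedProductIncl T cf)).comp continuous_subtype_val)

/-- Freeness enters here, through the vanishing on monomials with `n ≠ 0`; it gives injectivity of
`τ ↦ μ_τ`. -/
theorem trace_ext (hT : IsFreeHomeo T) {σ τ : TraceSpace (CrossedProduct T)}
    (h : ∀ f : C(X, ℂ), (σ : WeakDual ℂ (CrossedProduct T)) (crossedProductIncl T f) =
      (τ : WeakDual ℂ (CrossedProduct T)) (crossedProductIncl T f)) : σ = τ := by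
  apply Subtype.ext
  apply WeakDual.toStrongDual.injective
  refine crossedProduct_clm_ext fun f n => ?_
  change (σ : WeakDual ℂ (CrossedProduct T)) _ = (τ : WeakDual ℂ (CrossedProduct T)) _
  by_cases hn : n = 0
  · subst hn
    rw [crossedProductMonomial_zero]; exact h f
  · rw [trace_monomial_eq_zero hT σ f hn, trace_monomial_eq_zero hT τ f hn]

/-- The homeomorphism `τ ↦ μ_τ` from the trace space to the space of invariant measures. -/
def traceSpaceHomeo [Nonempty X] (hT : IsFreeHomeo T) :
    TraceSpace (CrossedProduct T) ≃ₜ InvariantProb T where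
  toFun := measureOfTrace
  invFun := traceOfMeasure
  left_inv τ := trace_ext hT fun f => by
    rw [trace_incl_eq_integral τ]; exact measureFunctional_incl _ f
  right_inv μ := Subtype.ext (ProbabilityMeasure.ext_of_integral_complex fun f => by
    rw [← trace_incl_eq_integral]; exact measureFunctional_incl _ f)
  continuous_toFun := continuous_measureOfTrace
  continuous_invFun := continuous_traceOfMeasure

end MeasuresOfTraces

/-! ### Verification of the lyriform axioms -/

section Lyriform

variable {X : Type u} [MetricSpace X] [CompactSpace X] [Nonempty X] [MeasurableSpace X]
  [BorelSpace X] {T : X ≃ₜ X}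

/-- Both sides integrate every continuous function to the same value; this transfers joint convexity
of `dbar` to traces. -/
theorem measureOfTrace_convexComb {n : ℕ} {c : Fin n → ℝ} (hc : c ∈ stdSimplex ℝ (Fin n))
    (σ : Fin n → TraceSpace (CrossedProduct T)) :
    ((measureOfTrace (TraceSpace.convexComb c hc σ)).1 : Measure X) =
      ∑ i, ENNReal.ofReal (c i) • ((measureOfTrace (σ i)).1 : Measure X) := by
  have hsum : ∑ i, ENNReal.ofReal (c i) = 1 := by
    rw [← ENNReal.ofReal_sum_of_nonneg fun i _ => hc.1 i, hc.2, ENNReal.ofReal_one]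
  have hp : IsProbabilityMeasure
      (∑ i, ENNReal.ofReal (c i) • ((measureOfTrace (σ i)).1 : Measure X)) := ⟨by simp [hsum]⟩
  refine congrArg ProbabilityMeasure.toMeasure (ProbabilityMeasure.ext_of_integral_complex
    (ν := ⟨_, hp⟩) fun f => ?_)
  change _ = ∫ x, f x ∂(∑ i, ENNReal.ofReal (c i) • ((measureOfTrace (σ i)).1 : Measure X))
  rw [← trace_incl_eq_integral, integral_finsetSum_measure fun i _ =>
    (ContinuousMap.integrable_of_compactSpace f.continuous _).smul_measure ENNReal.ofReal_ne_top]
  simp only [integral_smul_measure, ENNReal.toReal_ofReal (hc.1 _), ← trace_incl_eq_integral]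
  change WeakDual.toStrongDual (∑ i, (c i : ℂ) • (σ i : WeakDual ℂ (CrossedProduct T))) _ = _
  simp only [map_sum, map_smul, sum_apply, smul_apply]
  rfl

theorem tracialLipschitzSeminorm_lt_top {A : Type v} [CStarAlgebra A]
    {ρ : TraceSpace A → TraceSpace A → ℝ} {a : A} (K : ℝ)
    (h : ∀ σ τ : TraceSpace A, σ ≠ τ →
      ‖(σ : WeakDual ℂ A) a - (τ : WeakDual ℂ A) a‖ / ρ σ τ ≤ K) :
    tracialLipschitzSeminorm ρ a < ⊤ :=
  (iSup_le fun σ => iSup_le fun τ => iSup_le fun hστ =>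
    ENNReal.ofReal_le_ofReal (h σ τ hστ)).trans_lt (ENNReal.ofReal_lt_top (r := K))

theorem dense_tracialLipschitz (hT : IsFreeHomeo T) :
    Dense {a : CrossedProduct T | tracialLipschitzSeminorm
      (fun σ τ => dbar T (measureOfTrace σ) (measureOfTrace τ)) a < ⊤} := by
  -- Bounding by a product instead of a quotient gives a subspace at once, with no case `σ = τ` to
  -- exclude.
  let S : Submodule ℂ (CrossedProduct T) :=
    { carrier := {a | ∃ K : ℝ, ∀ σ τ : TraceSpace (CrossedProduct T),
        ‖(σ : WeakDual ℂ (CrossedProduct T)) a - (τ : WeakDual ℂ (CrossedProduct T)) a‖ ≤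
          K * dbar T (measureOfTrace σ) (measureOfTrace τ)}
      add_mem' := by
        rintro a b ⟨K, hK⟩ ⟨L, hL⟩
        refine ⟨K + L, fun σ τ => ?_⟩
        rw [map_add, map_add, add_sub_add_comm, add_mul]
        exact (norm_add_le _ _).trans (add_le_add (hK σ τ) (hL σ τ))
      zero_mem' := ⟨0, fun σ τ => by simp⟩
      smul_mem' := by
        rintro c a ⟨K, hK⟩
        refine ⟨‖c‖ * K, fun σ τ => ?_⟩
        rw [map_smul, map_smul, ← smul_sub, norm_smul, mul_assoc]
        exact mul_le_mul_of_nonneg_left (hK σ τ) (norm_nonneg c) }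
  have hS : ∀ a, a ∈ S.topologicalClosure := by
    refine mem_of_crossedProductMonomial_mem S.isClosed_topologicalClosure fun f n => ?_
    by_cases hn : n = 0
    · subst hn
      rw [crossedProductMonomial_zero]
      refine closure_mono ?_ (image_closure_subset_closure_image continuous_crossedProductIncl
        ⟨f, dense_lipschitz_continuousMap X f, rfl⟩)
      rintro _ ⟨g, ⟨K, hK⟩, rfl⟩
      refine ⟨K, fun σ τ => ?_⟩
      rw [trace_incl_eq_integral, trace_incl_eq_integral]
      exact norm_integral_sub_le_dbar hK
    -- Every trace vanishes on these monomials, so the Lipschitz constant is `0`.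
    · refine S.le_topologicalClosure ⟨0, fun σ τ => ?_⟩
      rw [trace_monomial_eq_zero hT σ f hn, trace_monomial_eq_zero hT τ f hn]
      simp
  intro a
  refine closure_mono ?_ (hS a)
  rintro b ⟨K, hK⟩
  refine tracialLipschitzSeminorm_lt_top |K| fun σ τ _ => ?_
  exact div_le_of_le_mul₀ (dbar_nonneg _ _) (abs_nonneg K) ((hK σ τ).trans
    (mul_le_mul_of_nonneg_right (le_abs_self K) (dbar_nonneg _ _)))

theorem lowerSemicontinuous_dbar_measureOfTrace :
    LowerSemicontinuous fun p : TraceSpace (CrossedProduct T) × TraceSpace (CrossedProduct T) =>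
      dbar T (measureOfTrace p.1) (measureOfTrace p.2) := by
  have h : Continuous fun p : TraceSpace (CrossedProduct T) × TraceSpace (CrossedProduct T) =>
      (measureOfTrace p.1, measureOfTrace p.2) :=
    continuous_measureOfTrace.prodMap continuous_measureOfTrace
  exact fun p y hy => h.continuousAt.eventually
    (lowerSemicontinuous_dbar (T := T) (measureOfTrace p.1, measureOfTrace p.2) y hy)

theorem isTraciallyLyriform_crossedProduct (hT : IsFreeHomeo T) :
    IsTraciallyLyriform (CrossedProduct T)
      (fun σ τ => dbar T (measureOfTrace σ) (measureOfTrace τ)) where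
  separable := separableSpace_crossedProduct T
  nonempty := Nonempty.map (traceOfMeasure (T := T)) nonempty_invariantProb
  eq_zero_iff σ τ := dbar_eq_zero_iff.trans (traceSpaceHomeo hT).injective.eq_iff
  symm _ _ := dbar_comm _ _
  triangle _ _ _ := dbar_triangle _ _ _
  finite_diam := ⟨Metric.diam (Set.univ : Set X), by rintro _ ⟨p, rfl⟩; exact dbar_le_diam _ _⟩
  lowerSemicontinuous := lowerSemicontinuous_dbar_measureOfTrace
  effectively_quasiconvex := by
    -- Joint convexity of `dbar` allows `h` to be the identity.
    refine ⟨id, monotone_id.monotoneOn _, fun x hx => hx.1, tendsto_id.mono_left nhdsWithin_le_nhds,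
      fun n c hc σ τ M hM => ?_⟩
    exact dbar_le_of_convexComb hc (measureOfTrace_convexComb hc σ)
      (measureOfTrace_convexComb hc τ) fun i => hM.2 ⟨i, rfl⟩
  dense_lipschitz := dense_tracialLipschitz hT

end Lyriform

end

theorem mainTheorem12 {X : Type u} [MetricSpace X] [CompactSpace X] [Nonempty X]
    [MeasurableSpace X] [BorelSpace X] (T : X ≃ₜ X) (hT : IsFreeHomeo T) :
    ∃ Φ : TraceSpace (CrossedProduct T) ≃ₜ InvariantProb T,
      (∀ (τ : TraceSpace (CrossedProduct T)) (f : C(X, ℂ)),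
        (τ : WeakDual ℂ (CrossedProduct T)) (crossedProductIncl T f)
          = ∫ x, f x ∂((Φ τ).1 : Measure X)) ∧
      IsTraciallyLyriform (CrossedProduct T) (fun σ τ => dbar T (Φ σ) (Φ τ)) :=
  ⟨traceSpaceHomeo hT, trace_incl_eq_integral, isTraciallyLyriform_crossedProduct hT⟩
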